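/- For a permutation $\pi\in\mathfrak S_n$ ($n\ge 0$) let $\ell(\pi)$ be the least $k$ such that $\pi=s_{i_1}\cdots s_{i_k}$ is a product of $k$ simple reflections $s_i=(i\ i{+}1)$, and let $R(\pi)$ be the set of reduced words $i_1\cdots i_k$ (those with $k=\ell(\pi)$). Let $G_\pi$ be the graph on $R(\pi)$ in which two words are adjacent if they differ by a commutation move (switching adjacent letters $jk$ with $|j-k|>1$) or by a long braid move (exchanging $j(j+1)j$ and $(j+1)j(j+1)$ on consecutive positions). Let $C_\pi$ be the simple graph obtained from $G_\pi$ by contracting all commutation edges, and $B_\pi$ the simple graph obtained from $G_\pi$ by contracting all long braid edges. These graphs are connected; $\operatorname{diam}$ denotes the maximum distance between two vertices. Let $a,b\ge 0$, let $\alpha\in\mathfrak S_a$, and let $\pi=21[\alpha,\iota_b]\in\mathfrak S_{a+b}$ be the permutation with one-line notation $(\alpha_1+b)\cdots(\alpha_a+b)\,1\,2\cdots b$. Then $G_\alpha,C_\alpha,B_\alpha,G_\pi,C_\pi,B_\pi$ are connected and (i) $\operatorname{diam}(G_\alpha)+\ell(\alpha)b(a-1)+\binom a2\binom b2\le\operatorname{diam}(G_\pi)\le\operatorname{diam}(G_\alpha)+\ell(\alpha)b(a-1)+2\binom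 a2\binom b2$; (ii) $\operatorname{diam}(C_\pi)=\operatorname{diam}(C_\alpha)+\ell(\alpha)b$; (iii) $\operatorname{diam}(B_\alpha)+\ell(\alpha)b(a-2)+\binom a2\binom b2\le\operatorname{diam}(B_\pi)\le\operatorname{diam}(B_\alpha)+\ell(\alpha)b(a-2)+2\binom a2\binom b2$. -/

import Mathlib

namespace ReducedWords

/-- The simple reflection `s_i` of `Fin n`, interchanging the consecutive elements `i` and `i + 1`
(elements and letters are numbered from `0`, so the letters are `0, …, n - 2`). -/
def simpleRefl {n : ℕ} (i : Fin (n - 1)) : Equiv.Perm (Fin n) :=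
  Equiv.swap ⟨i.val, by omega⟩ ⟨i.val + 1, by omega⟩

/-- The product `s_{i₁} s_{i₂} ⋯ s_{i_k}` of a word `i₁ i₂ ⋯ i_k`, composed as functions
(the rightmost factor acts first). -/
def wordProd {n : ℕ} (w : List (Fin (n - 1))) : Equiv.Perm (Fin n) :=
  (w.map simpleRefl).prod

/-- The length `ℓ(π)`: the least number of simple reflections with product `π`. -/
noncomputable def permLength {n : ℕ} (π : Equiv.Perm (Fin n)) : ℕ :=
  sInf {k : ℕ | ∃ w : List (Fin (n - 1)), w.length = k ∧ wordProd w = π}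

/-- The set `R(π)` of reduced words of `π`. -/
def reducedWords {n : ℕ} (π : Equiv.Perm (Fin n)) : Set (List (Fin (n - 1))) :=
  {w | wordProd w = π ∧ w.length = permLength π}

/-- A commutation move: adjacent letters `j k` with `|j - k| > 1` are switched. -/
def CommMove {m : ℕ} (u v : List (Fin m)) : Prop :=
  ∃ (p q : List (Fin m)) (j k : Fin m), (j.val + 1 < k.val ∨ k.val + 1 < j.val) ∧
    u = p ++ [j, k] ++ q ∧ v = p ++ [k, j] ++ q

/-- A long braid move: `j (j+1) j` and `(j+1) j (j+1)`, on consecutive positions, are exchanged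
(in either direction). -/
def LongBraidMove {m : ℕ} (u v : List (Fin m)) : Prop :=
  ∃ (p q : List (Fin m)) (j k : Fin m), (j.val + 1 = k.val ∨ k.val + 1 = j.val) ∧
    u = p ++ [j, k, j] ++ q ∧ v = p ++ [k, j, k] ++ q

theorem CommMove.symm {m : ℕ} {u v : List (Fin m)} (h : CommMove u v) : CommMove v u := by
  obtain ⟨p, q, j, k, hjk, hu, hv⟩ := h
  exact ⟨p, q, k, j, hjk.symm, hv, hu⟩

theorem CommMove.ne {m : ℕ} {u v : List (Fin m)} (h : CommMove u v) : u ≠ v := by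
  obtain ⟨p, q, j, k, hjk, rfl, rfl⟩ := h
  intro he
  simp only [List.append_assoc, List.append_cancel_left_eq, List.cons_append,
    List.cons.injEq] at he
  have := congrArg Fin.val he.1
  omega

theorem LongBraidMove.symm {m : ℕ} {u v : List (Fin m)} (h : LongBraidMove u v) :
    LongBraidMove v u := by
  obtain ⟨p, q, j, k, hjk, hu, hv⟩ := h
  exact ⟨p, q, k, j, hjk.symm, hv, hu⟩

theorem LongBraidMove.ne {m : ℕ} {u v : List (Fin m)} (h : LongBraidMove u v) : u ≠ v := by
  obtain ⟨p, q, j, k, hjk, rfl, rfl⟩ := h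
  intro he
  simp only [List.append_assoc, List.append_cancel_left_eq, List.cons_append,
    List.cons.injEq] at he
  have := congrArg Fin.val he.1
  omega

/-- The graph on `R(π)` whose edges are the commutation edges only. -/
def commEdges {n : ℕ} (π : Equiv.Perm (Fin n)) : SimpleGraph (reducedWords π) where
  Adj u v := CommMove u.val v.val
  symm := ⟨fun _ _ h => h.symm⟩
  loopless := ⟨fun _ h => h.ne rfl⟩

/-- The graph on `R(π)` whose edges are the long braid edges only. -/
def braidEdges {n : ℕ} (π : Equiv.Perm (Fin n)) : SimpleGraph (reducedWords π) where
  Adj u v := LongBraidMove u.val v.val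
  symm := ⟨fun _ _ h => h.symm⟩
  loopless := ⟨fun _ h => h.ne rfl⟩

/-- `G_π`: the graph on `R(π)` whose edges are the commutation edges and the long braid edges. -/
def graphG {n : ℕ} (π : Equiv.Perm (Fin n)) : SimpleGraph (reducedWords π) :=
  commEdges π ⊔ braidEdges π

/-- The simple graph obtained from `G` by contracting the edges of `H`: its vertices are the
connected components of `H`, two different components being adjacent when some edge of `G`
joins them. -/
def contract {V : Type*} (G H : SimpleGraph V) : SimpleGraph H.ConnectedComponent where
  Adj S T := S ≠ T ∧
    ∃ u v : V, H.connectedComponentMk u = S ∧ H.connectedComponentMk v = T ∧ G.Adj u v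
  symm := ⟨fun _ _ ⟨hne, u, v, hu, hv, h⟩ => ⟨hne.symm, v, u, hv, hu, h.symm⟩⟩
  loopless := ⟨fun _ h => h.1 rfl⟩

/-- `C_π`: the graph `G_π` contracted along commutation edges; its vertices are the commutation
classes. -/
def graphC {n : ℕ} (π : Equiv.Perm (Fin n)) :
    SimpleGraph (commEdges π).ConnectedComponent :=
  contract (graphG π) (commEdges π)

/-- `B_π`: the graph `G_π` contracted along long braid edges; its vertices are the braid
classes. -/
def graphB {n : ℕ} (π : Equiv.Perm (Fin n)) :
    SimpleGraph (braidEdges π).ConnectedComponent :=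
  contract (graphG π) (braidEdges π)

/-- The inflation `21[α, β]`: the first `a` positions carry the values of `α` raised by `b`, the
last `b` positions carry the values of `β`. -/
def inflate21 {a b : ℕ} (α : Equiv.Perm (Fin a)) (β : Equiv.Perm (Fin b)) :
    Equiv.Perm (Fin (a + b)) :=
  finSumFinEquiv.symm.trans ((Equiv.sumCongr α β).trans
    ((Equiv.sumComm (Fin a) (Fin b)).trans (finSumFinEquiv.trans (finCongr (Nat.add_comm b a)))))

theorem inflate21_left {a b : ℕ} (α : Equiv.Perm (Fin a)) (β : Equiv.Perm (Fin b)) (i : Fin a) :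
    (inflate21 α β (Fin.castAdd b i)).val = (α i).val + b := by
  simp [inflate21]

theorem inflate21_right {a b : ℕ} (α : Equiv.Perm (Fin a)) (β : Equiv.Perm (Fin b)) (j : Fin b) :
    (inflate21 α β (Fin.natAdd a j)).val = (β j).val := by
  simp [inflate21]

end ReducedWords

/-!
A reduced word of `π` is determined by the list of pairs of strands (values) that its letters make
cross. On these label lists a commutation move reverses two adjacent labels without a common strand,
a long braid move reverses the three labels of three strands, and the diameters of `G`, `C` and `B`
are weighted diameters: a commutation move and a long braid move cost `(1, 1)`, `(0, 1)` and
`(1, 0)` respectively.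

For the upper bounds, the strands of `ι_b` can be made to move last or to move first. These two
normal forms give two routes between any two label lists of `π`. What each costs beyond the moves of
the labels of `α` depends on the order of the labels, but almost all of this dependence cancels in
the sum of the two costs, and the cheaper route costs at most the average.

For the lower bounds, the cost of making the strands of `ι_b` move last is a potential: a move of
the labels of `α` does not increase it, and any other move increases it by at most its own cost.
Compare a label list in which the strands of `ι_b` move last, one after the other, with one in which
each strand of `α` is crossed by all of them before any strands of `α` cross each other.
-/

namespace ReducedWords

/-! ### Weighted paths -/

/-- `WeightedReach r s p q u v c`: there is a path from `u` to `v` of total cost `c`, where an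
`r`-step costs `p` and an `s`-step costs `q`. The costs `(1, 1)`, `(0, 1)` and `(1, 0)` for
commutation and braid moves measure distances in `G_π`, `C_π` and `B_π`. -/
inductive WeightedReach {V : Type*} (r s : V → V → Prop) (p q : ℕ) : V → V → ℕ → Prop
  | refl (u : V) : WeightedReach r s p q u u 0
  | fst {u v w : V} {c : ℕ} : r u v → WeightedReach r s p q v w c →
      WeightedReach r s p q u w (p + c)
  | snd {u v w : V} {c : ℕ} : s u v → WeightedReach r s p q v w c →
      WeightedReach r s p q u w (q + c)

/-- `D` is the diameter of the set `S`: the maximum over `u, v ∈ S` of the least cost of a path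
from `u` to `v`. -/
def IsWeightedDiam {V : Type*} (r s : V → V → Prop) (p q : ℕ) (S : Set V) (D : ℕ) : Prop :=
  (∀ u ∈ S, ∀ v ∈ S, ∃ c ≤ D, WeightedReach r s p q u v c) ∧
    ∃ u ∈ S, ∃ v ∈ S, ∀ c, WeightedReach r s p q u v c → D ≤ c

namespace WeightedReach

variable {V W : Type*} {r s : V → V → Prop} {r' s' : W → W → Prop} {p q c d : ℕ} {u v w : V}

theorem single_fst (h : r u v) : WeightedReach r s p q u v p := .fst h (.refl v)

theorem single_snd (h : s u v) : WeightedReach r s p q u v q := .snd h (.refl v)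

theorem trans (huv : WeightedReach r s p q u v c) (hvw : WeightedReach r s p q v w d) :
    WeightedReach r s p q u w (c + d) := by
  induction huv with
  | refl u => simpa using hvw
  | fst h _ ih => rw [add_assoc]; exact .fst h (ih hvw)
  | snd h _ ih => rw [add_assoc]; exact .snd h (ih hvw)

theorem symm (hr : ∀ u v, r u v → r v u) (hs : ∀ u v, s u v → s v u)
    (huv : WeightedReach r s p q u v c) : WeightedReach r s p q v u c := by
  induction huv with
  | refl u => exact .refl u
  | fst h _ ih => rw [add_comm]; exact ih.trans (single_fst (hr _ _ h))
  | snd h _ ih => rw [add_comm]; exact ih.trans (single_snd (hs _ _ h))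

theorem map (φ : V → W) (hr : ∀ u v, r u v → r' (φ u) (φ v))
    (hs : ∀ u v, s u v → s' (φ u) (φ v)) (huv : WeightedReach r s p q u v c) :
    WeightedReach r' s' p q (φ u) (φ v) c := by
  induction huv with
  | refl u => exact .refl _
  | fst h _ ih => exact .fst (hr _ _ h) ih
  | snd h _ ih => exact .snd (hs _ _ h) ih

theorem simulate {R : V → W → Prop} (hR : ∀ {u x x'}, R u x → R u x' → x = x')
    (hr : ∀ {u v x}, r u v → R u x → ∃ y, r' x y ∧ R v y)
    (hs : ∀ {u v x}, s u v → R u x → ∃ y, s' x y ∧ R v y)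
    (huv : WeightedReach r s p q u v c) {x y : W} (hx : R u x) (hy : R v y) :
    WeightedReach r' s' p q x y c := by
  induction huv generalizing x with
  | refl u => rw [hR hx hy]; exact .refl y
  | fst h _ ih =>
    obtain ⟨x', hxx', hx'⟩ := hr h hx
    exact .fst hxx' (ih hx' hy)
  | snd h _ ih =>
    obtain ⟨x', hxx', hx'⟩ := hs h hx
    exact .snd hxx' (ih hx' hy)

theorem swap (huv : WeightedReach r s p q u v c) : WeightedReach s r q p u v c := by
  induction huv with
  | refl u => exact .refl u
  | fst h _ ih => exact .snd h ih
  | snd h _ ih => exact .fst h ih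

end WeightedReach

/-! ### Sums over ordered pairs of list entries -/

/-- The sum of `g x y` over all pairs of entries `x`, `y` of the list with `x` before `y`. -/
def pairSum {T M : Type*} [AddCommMonoid M] (g : T → T → M) : List T → M
  | [] => 0
  | x :: l => (l.map (g x)).sum + pairSum g l

section PairSum

variable {S T M : Type*} [AddCommMonoid M] (g g' : T → T → M)

theorem pairSum_append (l m : List T) :
    pairSum g (l ++ m) = pairSum g l + pairSum g m + (l.map fun x => (m.map (g x)).sum).sum := by
  induction l with
  | nil => simp [pairSum]
  | cons x l ih =>
    simp only [List.cons_append, pairSum, ih, List.map_append, List.sum_append, List.map_cons,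
      List.sum_cons]
    abel

theorem pairSum_concat (l : List T) (y : T) :
    pairSum g (l ++ [y]) = pairSum g l + (l.map fun x => g x y).sum := by
  simp [pairSum_append, pairSum]

theorem pairSum_reverse (l : List T) : pairSum g l.reverse = pairSum (fun x y => g y x) l := by
  induction l with
  | nil => rfl
  | cons x l ih =>
    rw [List.reverse_cons, pairSum_concat, ih, pairSum, List.map_reverse, List.sum_reverse,
      add_comm]

theorem pairSum_reverse_block (X Y I : List T) :
    pairSum g (X ++ I.reverse ++ Y) + pairSum g I =
      pairSum g (X ++ I ++ Y) + pairSum g I.reverse := by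
  simp only [pairSum_append, List.map_append, List.sum_append, List.map_reverse,
    List.sum_reverse]
  abel

theorem pairSum_flatMap (f : S → List T) (l : List S) :
    pairSum g (l.flatMap f) = (l.map fun s => pairSum g (f s)).sum +
      pairSum (fun s t => ((f s).map fun x => ((f t).map (g x)).sum).sum) l := by
  induction l with
  | nil => simp [pairSum]
  | cons s l ih =>
    have cross : ∀ m : List T, (m.map fun x => ((l.flatMap f).map (g x)).sum).sum =
        (l.map fun t => (m.map fun x => ((f t).map (g x)).sum).sum).sum := fun m => by
      clear ih; induction l <;> simp_all [List.sum_map_add]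
    rw [List.flatMap_cons, pairSum_append, ih, cross]
    simp only [pairSum, List.map_cons, List.sum_cons]
    abel

theorem pairSum_add (l : List T) :
    pairSum (fun x y => g x y + g' x y) l = pairSum g l + pairSum g' l := by
  induction l with
  | nil => simp [pairSum]
  | cons x l ih => simp only [pairSum, ih, List.sum_map_add]; abel

theorem pairSum_filter (t : T → Bool) (l : List T) :
    pairSum g (l.filter t) = pairSum (fun x y => if t x ∧ t y then g x y else 0) l := by
  have sum_filter : ∀ (f : T → M) (m : List T),
      ((m.filter t).map f).sum = (m.map fun y => if t y then f y else 0).sum := fun f m => by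
    induction m with
    | nil => rfl
    | cons y m ih => by_cases hy : t y <;> simp [hy, ih]
  induction l with
  | nil => rfl
  | cons x l ih => by_cases hx : t x <;> simp [pairSum, hx, ih, sum_filter]

theorem pairSum_const (c : M) (l : List T) :
    pairSum (fun _ _ => c) l = l.length.choose 2 • c := by
  induction l with
  | nil => simp [pairSum]
  | cons x l ih =>
    rw [pairSum, ih, List.map_const', List.sum_replicate, ← add_nsmul, List.length_cons,
      Nat.choose_succ_succ' _ 1, Nat.choose_one_right]

variable {g g'}

theorem pairSum_congr {l : List T} (h : l.Pairwise fun x y => g x y = g' x y) :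
    pairSum g l = pairSum g' l := by
  induction l with
  | nil => rfl
  | cons x l ih =>
    rw [List.pairwise_cons] at h
    rw [pairSum, pairSum, ih h.2, List.map_congr_left h.1]

theorem pairSum_eq_zero {l : List T} (h : l.Pairwise fun x y => g x y = 0) :
    pairSum g l = 0 := by
  rw [pairSum_congr h, pairSum_const, smul_zero]

theorem pairSum_perm (hg : ∀ x y, g x y = g y x) {l m : List T} (h : l.Perm m) :
    pairSum g l = pairSum g m := by
  induction h with
  | nil => rfl
  | cons x h ih => simp only [pairSum, ih, (h.map (g x)).sum_eq]
  | swap x y l => simp only [pairSum, List.map_cons, List.sum_cons, hg x y]; abel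
  | trans _ _ ih₁ ih₂ => exact ih₁.trans ih₂

end PairSum

/-! ### Label lists -/

/-- `Sorts A L B`: the list `A` of strands is transformed into `B` by interchanging adjacent
entries `x < y` step by step, `L` being the list of the pairs `(x, y)`, the labels of the
crossings. Label lists encode reduced words, and moves are easier to follow on them. -/
inductive Sorts {ι : Type*} [LinearOrder ι] : List ι → List (ι × ι) → List ι → Prop
  | nil (A : List ι) : Sorts A [] A
  | cons {P : List ι} {x y : ι} {Q : List ι} {L : List (ι × ι)} {B : List ι} : x < y →
      Sorts (P ++ y :: x :: Q) L B → Sorts (P ++ x :: y :: Q) ((x, y) :: L) B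

/-- The move that reverses a block of consecutive entries satisfying `T`. -/
def ReverseBlock {α : Type*} (T : List α → Prop) (L M : List α) : Prop :=
  ∃ X I Y, T I ∧ L = X ++ I ++ Y ∧ M = X ++ I.reverse ++ Y

namespace ReverseBlock

variable {α : Type*} {T : List α → Prop} {L M : List α}

theorem symm (hT : ∀ I, T I → T I.reverse) (h : ReverseBlock T L M) : ReverseBlock T M L := by
  obtain ⟨X, I, Y, hI, rfl, rfl⟩ := h
  exact ⟨X, I.reverse, Y, hT I hI, rfl, by simp⟩

theorem append (h : ReverseBlock T L M) (X Y : List α) :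
    ReverseBlock T (X ++ L ++ Y) (X ++ M ++ Y) := by
  obtain ⟨X', I, Y', hI, rfl, rfl⟩ := h
  exact ⟨X ++ X', I, Y' ++ Y, hI, by simp, by simp⟩

theorem reverse (hT : ∀ I, T I → T I.reverse) (h : ReverseBlock T L M) :
    ReverseBlock T L.reverse M.reverse := by
  obtain ⟨X, I, Y, hI, rfl, rfl⟩ := h
  exact ⟨Y.reverse, I.reverse, X.reverse, hT I hI, by simp, by simp⟩

theorem perm (h : ReverseBlock T L M) : L.Perm M := by
  obtain ⟨X, I, Y, -, rfl, rfl⟩ := h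
  exact (I.reverse_perm.symm.append_left X).append_right Y

end ReverseBlock

/-- The crossings labelled `l` and `m` have no strand in common. -/
def DisjointLabels {ι : Type*} (l m : ι × ι) : Prop :=
  l.1 ≠ m.1 ∧ l.1 ≠ m.2 ∧ l.2 ≠ m.1 ∧ l.2 ≠ m.2

theorem DisjointLabels.symm {ι : Type*} {l m : ι × ι} (h : DisjointLabels l m) :
    DisjointLabels m l :=
  ⟨h.1.symm, h.2.2.1.symm, h.2.1.symm, h.2.2.2.symm⟩

/-- A pair of disjoint labels: the crossings that a commutation move interchanges. -/
def IsDisjointPair {ι : Type*} (I : List (ι × ι)) : Prop :=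
  ∃ l m, DisjointLabels l m ∧ I = [l, m]

theorem IsDisjointPair.reverse {ι : Type*} (I : List (ι × ι)) (h : IsDisjointPair I) :
    IsDisjointPair I.reverse := by
  obtain ⟨l, m, hlm, rfl⟩ := h
  exact ⟨m, l, hlm.symm, rfl⟩

/-- The labels of the three crossings of three strands: the crossings that a long braid move
reverses. -/
inductive IsTriangle {ι : Type*} [LinearOrder ι] : List (ι × ι) → Prop
  | up {x y z : ι} : x < y → y < z → IsTriangle [(x, y), (x, z), (y, z)]
  | down {x y z : ι} : x < y → y < z → IsTriangle [(y, z), (x, z), (x, y)]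

theorem IsTriangle.reverse {ι : Type*} [LinearOrder ι] (I : List (ι × ι)) (h : IsTriangle I) :
    IsTriangle I.reverse := by
  cases h with
  | up hxy hyz => exact .down hxy hyz
  | down hxy hyz => exact .up hxy hyz

/-- Weighted paths of label lists. -/
abbrev LabelReach {ι : Type*} [LinearOrder ι] (p q : ℕ) :
    List (ι × ι) → List (ι × ι) → ℕ → Prop :=
  WeightedReach (ReverseBlock IsDisjointPair) (ReverseBlock IsTriangle) p q

namespace LabelReach

variable {ι : Type*} [LinearOrder ι] {p q c : ℕ} {L M : List (ι × ι)}

theorem symm (h : LabelReach p q L M c) : LabelReach p q M L c :=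
  WeightedReach.symm (fun _ _ => ReverseBlock.symm IsDisjointPair.reverse)
    (fun _ _ => ReverseBlock.symm IsTriangle.reverse) h

theorem append (h : LabelReach p q L M c) (X Y : List (ι × ι)) :
    LabelReach p q (X ++ L ++ Y) (X ++ M ++ Y) c :=
  h.map (fun N => X ++ N ++ Y) (fun _ _ hLM => hLM.append X Y) (fun _ _ hLM => hLM.append X Y)

theorem append_right (h : LabelReach p q L M c) (Y : List (ι × ι)) :
    LabelReach p q (L ++ Y) (M ++ Y) c := h.append [] Y

theorem append_left (h : LabelReach p q L M c) (X : List (ι × ι)) :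
    LabelReach p q (X ++ L) (X ++ M) c := by simpa using h.append X []

theorem reverse (h : LabelReach p q L M c) : LabelReach p q L.reverse M.reverse c :=
  h.map List.reverse (fun _ _ => ReverseBlock.reverse IsDisjointPair.reverse)
    (fun _ _ => ReverseBlock.reverse IsTriangle.reverse)

theorem perm (h : LabelReach p q L M c) : L.Perm M := by
  induction h with
  | refl => rfl
  | fst h _ ih => exact h.perm.trans ih
  | snd h _ ih => exact h.perm.trans ih

end LabelReach

namespace Sorts

variable {ι : Type*} [LinearOrder ι] {A B C : List ι} {L M : List (ι × ι)} {l : ι × ι}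

theorem single (P : List ι) {x y : ι} (h : x < y) (Q : List ι) :
    Sorts (P ++ x :: y :: Q) [(x, y)] (P ++ y :: x :: Q) := .cons h (.nil _)

theorem trans (h : Sorts A L B) (h' : Sorts B M C) : Sorts A (L ++ M) C := by
  induction h with
  | nil => exact h'
  | cons hxy _ ih => exact .cons hxy (ih h')

theorem eq_of_nil (h : Sorts A [] B) : A = B := by
  cases h; rfl

theorem exists_of_singleton (h : Sorts A [l] B) :
    ∃ P Q, l.1 < l.2 ∧ A = P ++ l.1 :: l.2 :: Q ∧ B = P ++ l.2 :: l.1 :: Q := by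
  cases h with
  | cons hxy h => exact ⟨_, _, hxy, rfl, h.eq_of_nil.symm⟩

theorem exists_of_append (h : Sorts A (L ++ M) B) : ∃ C, Sorts A L C ∧ Sorts C M B := by
  induction L generalizing A with
  | nil => exact ⟨A, .nil A, h⟩
  | cons l L ih =>
    cases h with
    | cons hxy h =>
      obtain ⟨C, hL, hM⟩ := ih h
      exact ⟨C, .cons hxy hL, hM⟩

theorem perm (h : Sorts A L B) : A.Perm B := by
  induction h with
  | nil => rfl
  | cons _ _ ih => exact ((List.Perm.swap _ _ _).append_left _).trans ih

theorem nodup (h : Sorts A L B) (hA : A.Nodup) : B.Nodup := h.perm.nodup_iff.1 hA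

theorem lt_of_mem (h : Sorts A L B) (hl : l ∈ L) : l.1 < l.2 := by
  induction h with
  | nil => simp at hl
  | cons hxy _ ih =>
    rcases List.mem_cons.1 hl with rfl | hl
    exacts [hxy, ih hl]

theorem mem_of_mem (h : Sorts A L B) (hl : l ∈ L) : l.1 ∈ A ∧ l.2 ∈ A := by
  induction h with
  | nil => simp at hl
  | @cons P x y Q _ _ _ _ ih =>
    rcases List.mem_cons.1 hl with rfl | hl
    · simp
    · simpa only [((List.Perm.swap x y Q).append_left P).mem_iff] using ih hl

theorem append_left (h : Sorts A L B) (X : List ι) : Sorts (X ++ A) L (X ++ B) := by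
  induction h with
  | nil => exact .nil _
  | @cons P x y Q L B hxy _ ih =>
    rw [← List.append_assoc] at ih ⊢
    exact .cons hxy ih

theorem append_right (h : Sorts A L B) (Y : List ι) : Sorts (A ++ Y) L (B ++ Y) := by
  induction h with
  | nil => exact .nil _
  | cons hxy _ ih =>
    rw [List.append_assoc, List.cons_append, List.cons_append] at ih ⊢
    exact .cons hxy ih

theorem reverse (h : Sorts A L B) : Sorts B.reverse L.reverse A.reverse := by
  induction h with
  | nil => exact .nil _
  | @cons P x y Q L B hxy _ ih =>
    rw [List.reverse_cons]
    refine ih.trans ?_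
    simpa using Sorts.single Q.reverse hxy P.reverse

theorem filter (t : ι → Bool) (h : Sorts A L B) :
    Sorts (A.filter t) (L.filter fun l => t l.1 && t l.2) (B.filter t) := by
  induction h with
  | nil => exact .nil _
  | @cons P x y Q L B hxy _ ih =>
    by_cases hx : t x <;> by_cases hy : t y
    · simp only [List.filter_append, List.filter_cons, hx, hy] at ih ⊢
      exact .cons hxy ih
    all_goals simpa [List.filter_cons, hx, hy] using ih

/-- Each crossing moves its smaller strand one place to the right and its larger strand one place
to the left. -/
theorem idxOf_add_countP (hA : A.Nodup) (h : Sorts A L B) (z : ι) :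
    B.idxOf z + L.countP (fun l => l.2 == z) = A.idxOf z + L.countP fun l => l.1 == z := by
  induction h with
  | nil => simp
  | @cons P x y Q _ _ _ _ ih =>
    have ih := ih (((List.Perm.swap y x Q).append_left P).nodup_iff.1 hA)
    grind [List.nodup_append]

end Sorts

/-! ### Moving one strand to the end -/

/-- The labels of the crossings that involve no strand of `Z`. -/
def avoiding {ι : Type*} [DecidableEq ι] (Z : List ι) (L : List (ι × ι)) : List (ι × ι) :=
  L.filter fun l => decide (l.1 ∉ Z) && decide (l.2 ∉ Z)

/-- The cost of moving the label `m` to the left across the label `l`, when `l.1` does not occur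
in `m`: if `l = (z, x)` and `m = (x, y)`, the label `(z, y)` stands between them and one braid
move passes both, which is why crossing `(z, y)` is free. -/
def labelWeight {ι : Type*} [DecidableEq ι] (p q : ℕ) (l m : ι × ι) : ℕ :=
  if l.2 = m.1 then q else if l.2 = m.2 then 0 else p

/-- The cost of moving the label `m` to the left across the label `l` if the strands of `Z` are to
move last, and among them those occurring earlier in `Z` after the others. Strands outside `Z`
have index `Z.length`, beyond the strands of `Z`. -/
def crossWeight {ι : Type*} [DecidableEq ι] (p q : ℕ) (Z : List ι) (l m : ι × ι) : ℕ :=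
  if Z.idxOf l.1 < Z.idxOf m.1 then labelWeight p q l m else 0

section Avoiding

variable {ι : Type*} [DecidableEq ι]

theorem mem_avoiding {Z : List ι} {L : List (ι × ι)} {l : ι × ι} :
    l ∈ avoiding Z L ↔ l ∈ L ∧ l.1 ∉ Z ∧ l.2 ∉ Z := by
  simp [avoiding]

theorem avoiding_append (Z : List ι) (L M : List (ι × ι)) :
    avoiding Z (L ++ M) = avoiding Z L ++ avoiding Z M :=
  List.filter_append ..

theorem avoiding_reverse (Z : List ι) (L : List (ι × ι)) :
    avoiding Z L.reverse = (avoiding Z L).reverse :=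
  List.filter_reverse ..

theorem avoiding_cons (z : ι) (Z : List ι) (L : List (ι × ι)) :
    avoiding (z :: Z) L = avoiding Z (avoiding [z] L) := by
  rw [avoiding, avoiding, avoiding, List.filter_filter]
  exact List.filter_congr fun l _ => by grind

theorem avoiding_congr_mem {Z Z' : List ι} (h : ∀ x, x ∈ Z ↔ x ∈ Z') (L : List (ι × ι)) :
    avoiding Z L = avoiding Z' L := by
  simp only [avoiding, h]

theorem avoiding_eq_self {Z : List ι} {L : List (ι × ι)} (h : ∀ l ∈ L, l.1 ∉ Z ∧ l.2 ∉ Z) :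
    avoiding Z L = L :=
  List.filter_eq_self.2 (by simpa using h)

theorem avoiding_eq_nil {Z : List ι} {L : List (ι × ι)} (h : ∀ l ∈ L, l.1 ∈ Z) :
    avoiding Z L = [] :=
  List.filter_eq_nil_iff.2 fun l hl => by simp [h l hl]

end Avoiding

theorem append_cons_eq_append_cons_cons_cases {α : Type*} {P Q P₁ Q₁ : List α} {x y z : α}
    (h : P ++ z :: Q = P₁ ++ x :: y :: Q₁) :
    (∃ D, P = P₁ ++ x :: y :: D ∧ Q₁ = D ++ z :: Q) ∨ (P = P₁ ++ [x] ∧ z = y ∧ Q = Q₁) ∨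
      (P = P₁ ∧ z = x ∧ Q = y :: Q₁) ∨ ∃ D, P₁ = P ++ z :: D ∧ Q = D ++ x :: y :: Q₁ := by
  rcases List.append_eq_append_iff.1 h with ⟨_ | ⟨d, D⟩, hP, hQ⟩ | ⟨_ | ⟨d, _ | ⟨e, D⟩⟩, hP, hQ⟩ <;>
    simp_all

theorem append_cons_inj_of_nodup {α : Type*} {z : α} {P Q P' Q' : List α}
    (h : (P ++ z :: Q).Nodup) (eq : P ++ z :: Q = P' ++ z :: Q') : P = P' ∧ Q = Q' := by
  have hz := List.nodup_middle.1 h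
  rw [List.nodup_cons, List.mem_append, not_or] at hz
  obtain ⟨hP, -, hQ⟩ := (List.append_cons_inj_of_notMem hz.1.1 hz.1.2).1 eq
  exact ⟨hP, hQ⟩

section Columns

variable {ι : Type*} [LinearOrder ι]

theorem Sorts.column {z : ι} {P : List ι} (h : ∀ x ∈ P, z < x) (Q : List ι) :
    Sorts (z :: P ++ Q) (P.map (Prod.mk z)) (P ++ z :: Q) := by
  induction P with
  | nil => exact .nil _
  | cons x P ih =>
    have rest := (ih fun y hy => h y (by simp [hy])).append_left [x]
    exact .cons (P := []) (h x (by simp)) (by simpa using rest)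

section Push

variable (p q : ℕ) {z x y : ι} {m : ι × ι} {P Q : List ι}

theorem labelReach_push_left (hz₁ : z ≠ m.1) (hz₂ : z ≠ m.2) (h₁ : m.1 ∉ P) (h₂ : m.2 ∉ P) :
    LabelReach p q (P.map (Prod.mk z) ++ [m]) (m :: P.map (Prod.mk z))
      (P.map fun x => labelWeight p q (z, x) m).sum := by
  induction P with
  | nil => exact .refl _
  | cons x P ih =>
    simp only [List.mem_cons, not_or] at h₁ h₂
    have rest := (ih h₁.2 h₂.2).append_left [(z, x)]
    have disjoint : DisjointLabels (z, x) m := ⟨hz₁, hz₂, Ne.symm h₁.1, Ne.symm h₂.1⟩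
    have swap := WeightedReach.single_fst (s := ReverseBlock IsTriangle) (p := p) (q := q)
      (show ReverseBlock IsDisjointPair _ _ from
        ⟨[], _, P.map (Prod.mk z), ⟨_, _, disjoint, rfl⟩, rfl, rfl⟩)
    have cost : ((x :: P).map fun x => labelWeight p q (z, x) m).sum =
        (P.map fun x => labelWeight p q (z, x) m).sum + p := by
      simp [labelWeight, Ne.symm h₁.1, Ne.symm h₂.1, add_comm]
    rw [cost]
    exact rest.trans swap

theorem labelReach_push_left_braid (hzx : z < x) (hxy : x < y) (hP : (P ++ x :: y :: Q).Nodup) :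
    LabelReach p q ((P ++ x :: y :: Q).map (Prod.mk z) ++ [(x, y)])
      ((x, y) :: (P ++ y :: x :: Q).map (Prod.mk z))
      ((P ++ x :: y :: Q).map fun x' => labelWeight p q (z, x') (x, y)).sum := by
  obtain ⟨⟨hxP, hyP⟩, hxQ, hyQ⟩ : (x ∉ P ∧ y ∉ P) ∧ x ∉ Q ∧ y ∉ Q := by
    grind [List.nodup_append]
  have hzy := hzx.trans hxy
  have across_Q := (labelReach_push_left p q (m := (x, y)) hzx.ne hzy.ne hxQ hyQ).append_left
    (P.map (Prod.mk z) ++ [(z, x), (z, y)])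
  have braid := WeightedReach.single_snd (r := ReverseBlock IsDisjointPair) (p := p) (q := q)
    (show ReverseBlock IsTriangle _ _ from
      ⟨P.map (Prod.mk z), _, Q.map (Prod.mk z), .up hzx hxy, rfl, rfl⟩)
  have across_P := (labelReach_push_left p q (m := (x, y)) hzx.ne hzy.ne hxP hyP).append_right
    ([(z, y), (z, x)] ++ Q.map (Prod.mk z))
  have cost : ((P ++ x :: y :: Q).map fun x' => labelWeight p q (z, x') (x, y)).sum =
      (Q.map fun x' => labelWeight p q (z, x') (x, y)).sum +
        (q + (P.map fun x' => labelWeight p q (z, x') (x, y)).sum) := by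
    simp only [List.map_append, List.map_cons, List.sum_append, List.sum_cons, labelWeight,
      if_true, hxy.ne', if_false]
    ring
  rw [cost]
  simp only [List.map_append, List.map_cons, List.reverse_cons, List.reverse_nil,
    List.nil_append, List.cons_append, List.append_assoc] at across_Q braid across_P ⊢
  exact across_Q.trans (braid.trans across_P)

/-- If the strand `z` has so far crossed exactly the strands `P`, one after the other, then one
more crossing `l` either extends these crossings or can be made to happen before them. -/
theorem Sorts.exists_labelReach_avoiding_singleton {S : List ι} {l : ι × ι}
    (hnd : (P ++ z :: Q).Nodup) (hP : ∀ x ∈ P, z < x) (h : Sorts (P ++ z :: Q) [l] S) :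
    ∃ P' Q', S = P' ++ z :: Q' ∧ (∀ x ∈ P', z < x) ∧
      LabelReach p q (P.map (Prod.mk z) ++ [l]) (avoiding [z] [l] ++ P'.map (Prod.mk z))
        (P.map fun x => crossWeight p q [z] (z, x) l).sum := by
  obtain ⟨P₁, Q₁, hl, hC, rfl⟩ := h.exists_of_singleton
  obtain ⟨x, y⟩ := l
  have avoids (hx : z ≠ x) (hy : z ≠ y) : avoiding [z] [(x, y)] = [(x, y)] :=
    avoiding_eq_self (by simp [hx.symm, hy.symm])
  have weight (hx : z ≠ x) (x' : ι) :
      crossWeight p q [z] (z, x') (x, y) = labelWeight p q (z, x') (x, y) := by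
    simp [crossWeight, hx]
  dsimp only at hl hC ⊢
  rcases append_cons_eq_append_cons_cons_cases hC with
    ⟨D, rfl, rfl⟩ | ⟨rfl, rfl, -⟩ | ⟨rfl, rfl, rfl⟩ | ⟨D, rfl, rfl⟩
  · have hzx : z < x := hP x (by simp)
    refine ⟨P₁ ++ y :: x :: D, Q, by simp, fun w hw => hP w (by grind), ?_⟩
    simp only [avoids hzx.ne (hzx.trans hl).ne, weight hzx.ne]
    exact labelReach_push_left_braid p q hzx hl (List.nodup_append.1 hnd).1
  · exact absurd (hP x (by simp)) hl.asymm
  · refine ⟨P ++ [y], Q₁, by simp, by simpa [or_imp, forall_and] using ⟨hP, hl⟩, ?_⟩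
    rw [avoiding_eq_nil (by simp), List.sum_eq_zero (by simp [crossWeight])]
    simpa using WeightedReach.refl _
  · obtain ⟨⟨hzx, hzy⟩, hxP, hyP⟩ : (z ≠ x ∧ z ≠ y) ∧ x ∉ P ∧ y ∉ P := by
      grind [List.nodup_append]
    refine ⟨P, D ++ y :: x :: Q₁, by simp, hP, ?_⟩
    simp only [avoids hzx hzy, weight hzx]
    exact labelReach_push_left p q hzx hzy hxP hyP

theorem Sorts.exists_labelReach_avoiding_head {A S : List ι} {L : List (ι × ι)}
    (hA : (z :: A).Nodup) (h : Sorts (z :: A) L S) :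
    ∃ P Q, S = P ++ z :: Q ∧ (∀ x ∈ P, z < x) ∧
      LabelReach p q L (avoiding [z] L ++ P.map (Prod.mk z))
        (pairSum (crossWeight p q [z]) L) := by
  induction L using List.reverseRecOn generalizing S with
  | nil => exact ⟨[], A, h.eq_of_nil.symm, by simp, .refl _⟩
  | append_singleton L l ih =>
    obtain ⟨C, hL, hl⟩ := h.exists_of_append
    obtain ⟨P, Q, rfl, hP, hR⟩ := ih hL
    obtain ⟨P', Q', hS, hP', hR'⟩ :=
      hl.exists_labelReach_avoiding_singleton p q (hL.nodup hA) hP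
    refine ⟨P', Q', hS, hP', ?_⟩
    have cost : (L.map fun m => crossWeight p q [z] m l).sum =
        (P.map fun x => crossWeight p q [z] (z, x) l).sum := by
      have zero : ∀ m ∈ avoiding [z] L, crossWeight p q [z] m l = 0 := fun m hm => by
        grind [crossWeight, mem_avoiding]
      rw [(hR.perm.map _).sum_eq, List.map_append, List.sum_append,
        List.map_congr_left zero, List.sum_map_zero, zero_add, List.map_map]
      rfl
    rw [pairSum_concat, cost, avoiding_append, List.append_assoc]
    refine (hR.append_right [l]).trans ?_
    rw [List.append_assoc]
    exact hR'.append_left _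

end Push

theorem filter_notMem_of_nodup {α : Type*} [DecidableEq α] {P Z Q : List α}
    (h : (P ++ (Z ++ Q)).Nodup) :
    ((P ++ (Z ++ Q)).filter fun x => decide (x ∉ Z)) = P ++ Q := by
  have keep : ∀ R : List α, (∀ x ∈ R, x ∉ Z) → (R.filter fun x => decide (x ∉ Z)) = R :=
    fun R hR => List.filter_eq_self.2 (by simpa using hR)
  rw [List.filter_append, List.filter_append, keep P (by grind), keep Q (by grind),
    List.filter_eq_nil_iff.2 (by simp), List.nil_append]

theorem Sorts.avoiding {Z A P Q : List ι} {L : List (ι × ι)} (hA : (Z ++ A).Nodup)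
    (h : Sorts (Z ++ A) L (P ++ (Z ++ Q))) : Sorts A (avoiding Z L) (P ++ Q) := by
  have filtered := h.filter fun x => decide (x ∉ Z)
  have keep_A := filter_notMem_of_nodup (P := []) hA
  rw [List.nil_append, List.nil_append] at keep_A
  rwa [filter_notMem_of_nodup (h.nodup hA), keep_A] at filtered

/-- Both label lists reach the normal form in which the first strand moves last. -/
theorem Sorts.exists_labelReach (p q : ℕ) {A B : List ι} {L M : List (ι × ι)} (hA : A.Nodup)
    (hL : Sorts A L B) (hM : Sorts A M B) : ∃ c, LabelReach p q L M c := by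
  induction A generalizing B L M with
  | nil =>
    have eq_nil : ∀ N, Sorts [] N B → N = [] := fun N hN =>
      List.eq_nil_iff_forall_not_mem.2 fun l hl => by simpa using (hN.mem_of_mem hl).1
    rw [eq_nil L hL, eq_nil M hM]
    exact ⟨0, .refl _⟩
  | cons z A ih =>
    obtain ⟨P, Q, rfl, -, hLP⟩ := hL.exists_labelReach_avoiding_head p q hA
    obtain ⟨P', Q', hS, -, hMP⟩ := hM.exists_labelReach_avoiding_head p q hA
    obtain rfl : P = P' := (append_cons_inj_of_nodup (hL.nodup hA) hS).1
    obtain ⟨c, hc⟩ := ih (List.nodup_cons.1 hA).2 (Sorts.avoiding (Z := [z]) hA hL)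
      (Sorts.avoiding (Z := [z]) hA hM)
    exact ⟨_, (hLP.trans (hc.append_right _)).trans hMP.symm⟩

end Columns

/-! ### Moving a block of strands to the end -/

/-- The labels of the crossings of the strands `Z` with the strands `B`, one strand of `Z` after
the other, the last one moving first. -/
def columns {ι : Type*} (Z B : List ι) : List (ι × ι) :=
  Z.reverse.flatMap fun z => B.map (Prod.mk z)

/-- The labels of the crossings of the strands `Z` with the strands `A`, one strand of `A` after
the other, the first one moving first. -/
def rows {ι : Type*} (Z A : List ι) : List (ι × ι) :=
  A.flatMap fun x => Z.reverse.map fun z => (z, x)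

theorem mem_columns {ι : Type*} {Z B : List ι} {l : ι × ι} :
    l ∈ columns Z B ↔ l.1 ∈ Z ∧ l.2 ∈ B := by
  obtain ⟨z, x⟩ := l
  simp [columns]

theorem mem_rows {ι : Type*} {Z A : List ι} {l : ι × ι} :
    l ∈ rows Z A ↔ l.1 ∈ Z ∧ l.2 ∈ A := by
  obtain ⟨z, x⟩ := l
  simp [rows, and_comm]

theorem columns_cons {ι : Type*} (z : ι) (Z B : List ι) :
    columns (z :: Z) B = columns Z B ++ B.map (Prod.mk z) := by
  simp [columns]

theorem crossWeight_cons {ι : Type*} [DecidableEq ι] (p q : ℕ) {z : ι} (Z : List ι) {l m : ι × ι}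
    (hl : l.2 ≠ z) (hm : m.2 ≠ z) :
    crossWeight p q (z :: Z) l m = crossWeight p q [z] l m +
      if (decide (l.1 ∉ [z]) && decide (l.2 ∉ [z])) ∧ (decide (m.1 ∉ [z]) && decide (m.2 ∉ [z]))
        then crossWeight p q Z l m else 0 := by
  by_cases hlz : l.1 = z <;> by_cases hmz : m.1 = z <;> grind [crossWeight]

section NormalForms

variable {ι : Type*} [LinearOrder ι] {Z A B : List ι} {L : List (ι × ι)}

theorem Sorts.columns (h : ∀ z ∈ Z, ∀ x ∈ B, z < x) :
    Sorts (Z ++ B) (columns Z B) (B ++ Z) := by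
  induction Z with
  | nil => simpa [ReducedWords.columns] using Sorts.nil B
  | cons z Z ih =>
    have block := (ih fun s hs => h s (by simp [hs])).append_left [z]
    rw [columns_cons]
    exact block.trans (by simpa using Sorts.column (h z (by simp)) Z)

theorem Sorts.row {x : ι} (h : ∀ z ∈ Z, z < x) :
    Sorts (Z ++ [x]) (Z.reverse.map fun z => (z, x)) (x :: Z) := by
  induction Z with
  | nil => exact .nil _
  | cons z Z ih =>
    have block := (ih fun s hs => h s (by simp [hs])).append_left [z]
    simpa using block.trans (Sorts.single [] (h z (by simp)) Z)

theorem Sorts.rows (h : ∀ z ∈ Z, ∀ x ∈ A, z < x) : Sorts (Z ++ A) (rows Z A) (A ++ Z) := by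
  induction A with
  | nil => simpa [ReducedWords.rows] using Sorts.nil Z
  | cons x A ih =>
    have row := (Sorts.row fun s hs => h s hs x (by simp)).append_right A
    have block := (ih fun s hs y hy => h s hs y (by simp [hy])).append_left [x]
    rw [List.append_assoc] at row
    exact row.trans block

theorem Sorts.labelReach_append_columns (p q : ℕ) (hA : (Z ++ A).Nodup)
    (h : Sorts (Z ++ A) L (B ++ Z)) :
    LabelReach p q L (ReducedWords.avoiding Z L ++ ReducedWords.columns Z B)
      (pairSum (crossWeight p q Z) L) ∧ ∀ z ∈ Z, ∀ x ∈ B, z < x := by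
  induction Z generalizing L with
  | nil =>
    rw [pairSum_eq_zero (List.pairwise_of_forall fun l m => by simp [crossWeight])]
    simpa [ReducedWords.avoiding, ReducedWords.columns] using WeightedReach.refl L
  | cons z Z ih =>
    obtain ⟨P, Q, hS, hP, hz⟩ := h.exists_labelReach_avoiding_head p q hA
    obtain ⟨rfl, rfl⟩ := append_cons_inj_of_nodup (h.nodup hA) hS
    obtain ⟨hZ, lt_of_mem_Z⟩ := ih (List.nodup_cons.1 hA).2 (Sorts.avoiding (Z := [z]) hA h)
    have snd_ne : ∀ l ∈ L, l.2 ≠ z := fun l hl => by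
      rcases List.mem_append.1 (hz.perm.mem_iff.1 hl) with hl | hl
      · simpa using (mem_avoiding.1 hl).2.2
      · obtain ⟨x, hx, rfl⟩ := List.mem_map.1 hl
        exact (hP x hx).ne'
    have cost : pairSum (crossWeight p q (z :: Z)) L = pairSum (crossWeight p q [z]) L +
        pairSum (crossWeight p q Z) (ReducedWords.avoiding [z] L) := by
      rw [ReducedWords.avoiding, pairSum_filter, ← pairSum_add]
      exact pairSum_congr (List.pairwise_of_forall_mem_list fun l hl m hm =>
        crossWeight_cons p q Z (snd_ne l hl) (snd_ne m hm))
    rw [cost, columns_cons, avoiding_cons, ← List.append_assoc]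
    exact ⟨hz.trans (hZ.append_right _), by simpa using ⟨hP, lt_of_mem_Z⟩⟩

/-- The other normal form, obtained by symmetry under reversal. -/
theorem Sorts.labelReach_columns_append (p q : ℕ) (hA : (Z ++ A).Nodup)
    (h : Sorts (Z ++ A) L (B ++ Z)) :
    LabelReach p q L
      ((ReducedWords.columns Z.reverse A.reverse).reverse ++ ReducedWords.avoiding Z L)
      (pairSum (fun l m => crossWeight p q Z.reverse m l) L) := by
  have hrev := h.reverse
  rw [List.reverse_append, List.reverse_append] at hrev
  have hB : (Z.reverse ++ B.reverse).Nodup := by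
    rw [← List.reverse_append, List.nodup_reverse]
    exact h.nodup hA
  have reach := (hrev.labelReach_append_columns p q hB).1.reverse
  rwa [avoiding_reverse, List.reverse_append, List.reverse_reverse, List.reverse_reverse,
    avoiding_congr_mem (fun _ => List.mem_reverse), pairSum_reverse] at reach

end NormalForms

/-! ### Counting crossings -/

theorem pairSum_le_pairSum {T : Type*} {g g' : T → T → ℕ} {l : List T}
    (h : l.Pairwise fun x y => g x y ≤ g' x y) : pairSum g l ≤ pairSum g' l := by
  induction l with
  | nil => rfl
  | cons x l ih =>
    rw [List.pairwise_cons] at h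
    exact add_le_add (List.sum_le_sum h.1) (ih h.2)

theorem one_le_pairSum_of_idxOf_lt {T : Type*} [DecidableEq T] {x y : T} {l : List T}
    (hxy : l.idxOf x < l.idxOf y) (hy : y ∈ l) :
    1 ≤ pairSum (fun s t => if x = s ∧ y = t then 1 else 0) l := by
  induction l with
  | nil => simp at hy
  | cons z l ih =>
    obtain ⟨hyz, hyl⟩ : y ≠ z ∧ y ∈ l := by grind
    rw [pairSum]
    by_cases hx : x = z
    · refine (List.single_le_sum (by simp) 1 (List.mem_map.2 ⟨y, hyl, ?_⟩)).trans
        (Nat.le_add_right _ _)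
      simp [hx]
    · exact (ih (by grind) hyl).trans (Nat.le_add_left _ _)

theorem idxOf_le_idxOf_of_sublist {T : Type*} [DecidableEq T] {l m : List T} (h : l.Sublist m)
    (hm : m.Nodup) {x : T} (hx : x ∈ l) : l.idxOf x ≤ m.idxOf x := by
  induction h <;> grind

theorem pairwise_idxOf_add_le_of_sublist {T : Type*} [DecidableEq T] {l m : List T}
    (h : l.Sublist m) (hm : m.Nodup) :
    l.Pairwise fun x y => m.idxOf x + l.idxOf y ≤ m.idxOf y + l.idxOf x := by
  induction h with
  | slnil => exact .nil
  | cons a h ih =>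
    rw [List.nodup_cons] at hm
    refine (ih hm.2).imp_of_mem fun hx hy hxy => ?_
    have := h.subset hx
    have := h.subset hy
    grind
  | cons_cons a h ih =>
    rw [List.nodup_cons] at hm
    refine List.pairwise_cons.2 ⟨fun y hy => ?_, (ih hm.2).imp_of_mem fun hx hy hxy => ?_⟩
    · have := idxOf_le_idxOf_of_sublist h hm.2 hy
      grind
    · have := h.subset hx
      have := h.subset hy
      grind

/-- The cost of a pair of crossings of two strands of `Z`, if these do not cross the same
strand. -/
def smallWeight {ι : Type*} [DecidableEq ι] (p : ℕ) (Z : List ι) (l m : ι × ι) : ℕ :=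
  if Z.idxOf l.1 < Z.idxOf m.1 ∧ m.1 ∈ Z ∧ l.2 ≠ m.2 then p else 0

theorem sum_smallWeight_le {ι : Type*} [DecidableEq ι] (p : ℕ) (Z : List ι) (L : List (ι × ι))
    (m : ι × ι) : (L.map fun l => smallWeight p Z l m).sum ≤
      p * pairSum (fun s t => if m.1 = t then L.countP (fun l => l.1 == s) else 0) Z := by
  induction L with
  | nil => simp
  | cons l L ih =>
    have head : smallWeight p Z l m ≤
        p * pairSum (fun s t => if l.1 = s ∧ m.1 = t then 1 else 0) Z := by
      rw [smallWeight]
      split_ifs with hlm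
      · exact Nat.le_mul_of_pos_right p (one_le_pairSum_of_idxOf_lt hlm.1 hlm.2.1)
      · exact Nat.zero_le _
    have split : (fun s t => if m.1 = t then (l :: L).countP (fun l => l.1 == s) else 0) =
        fun s t => (if l.1 = s ∧ m.1 = t then 1 else 0) +
          if m.1 = t then L.countP (fun l => l.1 == s) else 0 := by
      funext s t
      grind
    rw [split, pairSum_add, mul_add, List.map_cons, List.sum_cons]
    exact add_le_add head ih

section PairCounts

variable {ι : Type*} [LinearOrder ι] {Z A B S : List ι} {L : List (ι × ι)}

theorem Sorts.sublist (h : Sorts (Z ++ A) L S) (hL : ∀ l ∈ L, l.2 ∉ Z) : Z.Sublist S := by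
  have filtered := h.filter fun x => decide (x ∈ Z)
  rw [List.filter_eq_nil_iff (l := L).2 fun l hl => by simp [hL l hl]] at filtered
  have filter_Z : Z.filter (fun x => decide (x ∈ Z)) = Z := List.filter_eq_self.2 (by simp)
  have filter_S := filtered.eq_of_nil
  rw [List.filter_append, filter_Z] at filter_S
  exact (List.sublist_append_left ..).trans (filter_S ▸ List.filter_sublist)

theorem Sorts.idxOf_eq (hA : (Z ++ A).Nodup) (h : Sorts (Z ++ A) L S) (hL : ∀ l ∈ L, l.2 ∉ Z)
    {z : ι} (hz : z ∈ Z) : S.idxOf z = Z.idxOf z + L.countP fun l => l.1 == z := by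
  have count := h.idxOf_add_countP hA z
  rwa [List.countP_eq_zero.2 fun l hl => by grind, List.idxOf_append_of_mem hz] at count

theorem Sorts.pairwise_countP_le (hA : (Z ++ A).Nodup) (h : Sorts (Z ++ A) L S)
    (hL : ∀ l ∈ L, l.2 ∉ Z) :
    Z.Pairwise fun s t => L.countP (fun l => l.1 == s) ≤ L.countP fun l => l.1 == t := by
  refine (pairwise_idxOf_add_le_of_sublist (h.sublist hL) (h.nodup hA)).imp_of_mem
    fun hs ht hst => ?_
  rw [h.idxOf_eq hA hL hs, h.idxOf_eq hA hL ht] at hst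
  lia

theorem Sorts.pairSum_smallWeight_le_pairSum (p : ℕ) (hA : (Z ++ A).Nodup)
    (h : Sorts (Z ++ A) L S) (hL : ∀ l ∈ L, l.2 ∉ Z) :
    pairSum (smallWeight p Z) L ≤
      p * pairSum (fun _ t => (L.countP fun l => l.1 == t).choose 2) Z := by
  induction L using List.reverseRecOn generalizing S with
  | nil => simp [pairSum]
  | append_singleton L m ih =>
    obtain ⟨C, hC, -⟩ := h.exists_of_append
    have hL' : ∀ l ∈ L, l.2 ∉ Z := fun l hl => hL l (by simp [hl])
    have split : (fun _ t : ι => ((L ++ [m]).countP fun l => l.1 == t).choose 2) =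
        fun _ t => (L.countP fun l => l.1 == t).choose 2 +
          if m.1 = t then L.countP (fun l => l.1 == t) else 0 := by
      funext _ t
      rw [List.countP_append, List.countP_singleton]
      by_cases ht : m.1 = t
      · simp only [ht, beq_self_eq_true, if_true]
        rw [Nat.choose_succ_succ' _ 1, Nat.choose_one_right, add_comm]
      · simp [ht]
    rw [pairSum_concat, split, pairSum_add, mul_add]
    refine add_le_add (ih hC hL') ((sum_smallWeight_le p Z L m).trans ?_)
    refine Nat.mul_le_mul_left p (pairSum_le_pairSum ?_)
    exact (hC.pairwise_countP_le hA hL').imp fun hst => by split_ifs <;> simp [hst]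

theorem Sorts.pairSum_smallWeight_le (p : ℕ) (hA : (Z ++ A).Nodup)
    (h : Sorts (Z ++ A) L (B ++ Z)) (hL : ∀ l ∈ L, l.2 ∉ Z) :
    pairSum (smallWeight p Z) L ≤ p * (B.length.choose 2 * Z.length.choose 2) := by
  have count_le : ∀ z ∈ Z, (L.countP fun l => l.1 == z) ≤ B.length := fun z hz => by
    have hzB : z ∉ B := fun hzB => (List.nodup_append.1 (h.nodup hA)).2.2 z hzB z hz rfl
    have idx := h.idxOf_eq hA hL hz
    rw [List.idxOf_append_of_notMem hzB] at idx
    lia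
  calc pairSum (smallWeight p Z) L
      ≤ p * pairSum (fun _ t => (L.countP fun l => l.1 == t).choose 2) Z :=
        h.pairSum_smallWeight_le_pairSum p hA hL
    _ ≤ p * pairSum (fun _ _ => B.length.choose 2) Z := by
        refine Nat.mul_le_mul_left p (pairSum_le_pairSum ?_)
        exact List.pairwise_of_forall_mem_list fun _ _ t ht =>
          Nat.choose_le_choose 2 (count_le t ht)
    _ = p * (B.length.choose 2 * Z.length.choose 2) := by
        rw [pairSum_const, smul_eq_mul, mul_comm (Z.length.choose 2)]

end PairCounts

/-! ### The upper bound -/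

theorem sum_map_sum_map_comm {S T M : Type*} [AddCommMonoid M] (l : List S) (m : List T)
    (f : S → T → M) :
    (l.map fun x => (m.map (f x)).sum).sum = (m.map fun y => (l.map fun x => f x y).sum).sum := by
  simpa using Multiset.sum_map_sum_map (l : Multiset S) (m : Multiset T) (f := f)

theorem sum_map_flatMap {S T M : Type*} [AddMonoid M] (l : List S) (f : S → List T)
    (g : T → M) :
    ((l.flatMap f).map g).sum = (l.map fun x => ((f x).map g).sum).sum := by
  simp [List.flatMap_def, List.sum_flatten, Function.comp_def]

theorem sum_map_eq_length_mul {T : Type*} {l : List T} {f : T → ℕ} {c : ℕ}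
    (h : ∀ x ∈ l, f x = c) : (l.map f).sum = l.length * c := by
  simp [List.map_congr_left h]

theorem idxOf_reverse_add_idxOf {T : Type*} [DecidableEq T] {l : List T} (h : l.Nodup) {x : T}
    (hx : x ∈ l) : l.reverse.idxOf x + l.idxOf x + 1 = l.length := by
  induction l <;> grind

section Weights

variable {ι : Type*} [DecidableEq ι]

/-- The part of the cost that comes from a crossing of a strand of `Z` and a crossing of no strand
of `Z`, in either order. -/
def mixedWeight (p q : ℕ) (Z : List ι) (l m : ι × ι) : ℕ :=
  (if l.1 ∈ Z ∧ m.1 ∉ Z then labelWeight p q l m else 0) +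
    if m.1 ∈ Z ∧ l.1 ∉ Z then labelWeight p q m l else 0

variable (p q : ℕ) {Z B : List ι} {l m : ι × ι}

theorem mixedWeight_comm (Z : List ι) (l m : ι × ι) :
    mixedWeight p q Z l m = mixedWeight p q Z m l :=
  add_comm _ _

theorem crossWeight_add_crossWeight_reverse (hZ : Z.Nodup) (hl : l.2 ∉ Z) (hm : m.2 ∉ Z) :
    crossWeight p q Z l m + crossWeight p q Z.reverse m l =
      mixedWeight p q Z l m + (smallWeight p Z l m + smallWeight p Z l m) := by
  have idx := fun x hx => idxOf_reverse_add_idxOf hZ (x := x) hx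
  have idx_l := idx l.1
  have idx_m := idx m.1
  by_cases hl₁ : l.1 ∈ Z <;> by_cases hm₁ : m.1 ∈ Z <;>
    grind [crossWeight, mixedWeight, smallWeight, labelWeight]

theorem sum_labelWeight (hB : B.Nodup) (h₁ : m.1 ∈ B) (h₂ : m.2 ∈ B) (h : m.1 ≠ m.2) (z : ι) :
    (B.map fun x => labelWeight p q (z, x) m).sum = (B.length - 2) * p + q := by
  have perm : B.Perm (m.1 :: m.2 :: (B.erase m.1).erase m.2) :=
    (List.perm_cons_erase h₁).trans
      ((List.perm_cons_erase ((List.mem_erase_of_ne h.symm).2 h₂)).cons _)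
  have rest : ∀ x ∈ (B.erase m.1).erase m.2, labelWeight p q (z, x) m = p := by
    have := perm.nodup_iff.1 hB
    grind [labelWeight]
  rw [(perm.map _).sum_eq, perm.length_eq, List.map_cons, List.map_cons, List.sum_cons,
    List.sum_cons, sum_map_eq_length_mul rest, List.length_cons, List.length_cons,
    Nat.add_sub_cancel (m := 2)]
  simp [labelWeight, h.symm, add_comm]

theorem sum_columns_labelWeight (Z : List ι) (hB : B.Nodup) (h₁ : m.1 ∈ B) (h₂ : m.2 ∈ B)
    (h : m.1 ≠ m.2) :
    ((columns Z B).map fun l => labelWeight p q l m).sum =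
      Z.length * ((B.length - 2) * p + q) := by
  rw [columns, sum_map_flatMap, ← List.length_reverse (as := Z)]
  refine sum_map_eq_length_mul fun z _ => ?_
  rw [List.map_map]
  exact sum_labelWeight p q hB h₁ h₂ h z

end Weights

section UpperBound

variable {ι : Type*} [LinearOrder ι] {Z A B : List ι} {L u : List (ι × ι)} (p q : ℕ)

theorem Sorts.pairSum_mixedWeight (hB : (B ++ Z).Nodup) (hu : Sorts A u B) :
    pairSum (mixedWeight p q Z) (u ++ ReducedWords.columns Z B) =
      u.length * (Z.length * ((B.length - 2) * p + q)) := by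
  have mem_B : ∀ l ∈ u, l.1 ∈ B ∧ l.2 ∈ B := fun l hl => by
    simpa only [hu.perm.mem_iff] using hu.mem_of_mem hl
  have fst_notMem : ∀ l ∈ u, l.1 ∉ Z := fun l hl hZ =>
    (List.nodup_append.1 hB).2.2 _ (mem_B l hl).1 _ hZ rfl
  have fst_mem : ∀ l ∈ ReducedWords.columns Z B, l.1 ∈ Z := fun l hl => (mem_columns.1 hl).1
  have within_u : pairSum (mixedWeight p q Z) u = 0 :=
    pairSum_eq_zero (List.pairwise_of_forall_mem_list fun l hl m hm => by
      simp [mixedWeight, fst_notMem l hl, fst_notMem m hm])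
  have within_columns : pairSum (mixedWeight p q Z) (ReducedWords.columns Z B) = 0 :=
    pairSum_eq_zero (List.pairwise_of_forall_mem_list fun l hl m hm => by
      simp [mixedWeight, fst_mem l hl, fst_mem m hm])
  rw [pairSum_append, within_u, within_columns, zero_add, zero_add]
  refine sum_map_eq_length_mul fun l hl => ?_
  rw [← sum_columns_labelWeight p q Z (List.nodup_append.1 hB).1 (mem_B l hl).1 (mem_B l hl).2
    (hu.lt_of_mem hl).ne]
  refine congrArg List.sum (List.map_congr_left fun m hm => ?_)
  simp [mixedWeight, fst_notMem l hl, fst_mem m hm]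

theorem Sorts.snd_notMem (hA : (Z ++ A).Nodup) (h : Sorts (Z ++ A) L (B ++ Z)) {l : ι × ι}
    (hl : l ∈ L) : l.2 ∉ Z := by
  rcases List.mem_append.1 ((h.labelReach_append_columns 0 0 hA).1.perm.mem_iff.1 hl) with hl | hl
  · exact (mem_avoiding.1 hl).2.2
  · exact fun hZ => (List.nodup_append.1 (h.nodup hA)).2.2 _ (mem_columns.1 hl).2 _ hZ rfl

theorem Sorts.avoiding_prefix (hA : (Z ++ A).Nodup) (h : Sorts (Z ++ A) L (B ++ Z)) :
    Sorts A (ReducedWords.avoiding Z L) B := by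
  have := Sorts.avoiding (P := B) (Q := []) hA (by rwa [List.append_nil])
  rwa [List.append_nil] at this

theorem Sorts.pairSum_crossWeight_add_le (hA : (Z ++ A).Nodup) (h : Sorts (Z ++ A) L (B ++ Z)) :
    pairSum (crossWeight p q Z) L + pairSum (fun l m => crossWeight p q Z.reverse m l) L ≤
      (ReducedWords.avoiding Z L).length * (Z.length * ((B.length - 2) * p + q)) +
        2 * (p * (B.length.choose 2 * Z.length.choose 2)) := by
  have weights : L.Pairwise fun l m =>
      crossWeight p q Z l m + crossWeight p q Z.reverse m l =
        mixedWeight p q Z l m + (smallWeight p Z l m + smallWeight p Z l m) :=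
    List.pairwise_of_forall_mem_list fun l hl m hm =>
      crossWeight_add_crossWeight_reverse p q (List.nodup_append.1 hA).1
        (h.snd_notMem hA hl) (h.snd_notMem hA hm)
  rw [← pairSum_add, pairSum_congr weights, pairSum_add, pairSum_add,
    pairSum_perm (mixedWeight_comm p q Z) (h.labelReach_append_columns p q hA).1.perm,
    (h.avoiding_prefix hA).pairSum_mixedWeight p q (h.nodup hA)]
  have := h.pairSum_smallWeight_le p hA fun l hl => h.snd_notMem hA hl
  lia

/-- `D` is the diameter of the set of label lists that lead from `A` to `B`. -/
abbrev IsLabelDiam (p q : ℕ) (A B : List ι) (D : ℕ) : Prop :=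
  IsWeightedDiam (ReverseBlock IsDisjointPair) (ReverseBlock IsTriangle) p q {L | Sorts A L B} D

/-- The two normal forms give two routes between label lists; the shorter one costs at most the
average. -/
theorem IsLabelDiam.le {k D D' : ℕ} (hA : (Z ++ A).Nodup)
    (hk : ∀ u, Sorts A u B → u.length = k) (hD : IsLabelDiam p q A B D)
    (hD' : IsLabelDiam p q (Z ++ A) (B ++ Z) D') :
    D' ≤ D + k * (Z.length * ((B.length - 2) * p + q)) +
      2 * (p * (B.length.choose 2 * Z.length.choose 2)) := by
  obtain ⟨L, hL, M, hM, hmin⟩ := hD'.2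
  have hLu := hL.avoiding_prefix hA
  have hMu := hM.avoiding_prefix hA
  obtain ⟨c, hc, reach⟩ := hD.1 _ hLu _ hMu
  have route₁ := hmin _ (((hL.labelReach_append_columns p q hA).1.trans
    (LabelReach.append_right reach _)).trans (hM.labelReach_append_columns p q hA).1.symm)
  have route₂ := hmin _ (((hL.labelReach_columns_append p q hA).trans
    (LabelReach.append_left reach _)).trans (hM.labelReach_columns_append p q hA).symm)
  have sum_L := hL.pairSum_crossWeight_add_le p q hA
  have sum_M := hM.pairSum_crossWeight_add_le p q hA
  rw [hk _ hLu] at sum_L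
  rw [hk _ hMu] at sum_M
  lia

end UpperBound

/-! ### The lower bound -/

section Step

variable {ι : Type*} [DecidableEq ι] {p q : ℕ} {Z : List ι}

theorem ReverseBlock.avoiding_or {T : List (ι × ι) → Prop} {c : ℕ} {L M : List (ι × ι)}
    (hT : ∀ I, T I → (∀ l ∈ I, l.2 ∉ Z) →
      (T (avoiding Z I) ∧
        pairSum (crossWeight p q Z) I.reverse ≤ pairSum (crossWeight p q Z) I) ∨
      (avoiding Z I.reverse = avoiding Z I ∧
        pairSum (crossWeight p q Z) I.reverse ≤ pairSum (crossWeight p q Z) I + c))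
    (h : ReverseBlock T L M) (hL : ∀ l ∈ L, l.2 ∉ Z) :
    (ReverseBlock T (avoiding Z L) (avoiding Z M) ∧
        pairSum (crossWeight p q Z) M ≤ pairSum (crossWeight p q Z) L) ∨
      (avoiding Z M = avoiding Z L ∧
        pairSum (crossWeight p q Z) M ≤ pairSum (crossWeight p q Z) L + c) := by
  obtain ⟨X, I, Y, hI, rfl, rfl⟩ := h
  have weight := pairSum_reverse_block (crossWeight p q Z) X Y I
  simp only [avoiding_append]
  rcases hT I hI fun l hl => hL l (by simp [hl]) with ⟨block, hle⟩ | ⟨eq, hle⟩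
  · exact .inl ⟨⟨_, _, _, block, rfl, by rw [avoiding_reverse]⟩, by lia⟩
  · exact .inr ⟨by rw [eq], by lia⟩

theorem IsDisjointPair.avoiding_or {I : List (ι × ι)} (h : IsDisjointPair I) :
    (IsDisjointPair (avoiding Z I) ∧
        pairSum (crossWeight p q Z) I.reverse ≤ pairSum (crossWeight p q Z) I) ∨
      (avoiding Z I.reverse = avoiding Z I ∧
        pairSum (crossWeight p q Z) I.reverse ≤ pairSum (crossWeight p q Z) I + p) := by
  obtain ⟨l, m, hlm, rfl⟩ := h
  have pairSum_pair : ∀ l m, pairSum (crossWeight p q Z) [l, m] = crossWeight p q Z l m := by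
    simp [pairSum]
  simp only [List.reverse_cons, List.reverse_nil, List.nil_append, List.cons_append, pairSum_pair]
  by_cases hl : l.1 ∉ Z ∧ l.2 ∉ Z <;> by_cases hm : m.1 ∉ Z ∧ m.2 ∉ Z
  · left
    rw [avoiding_eq_self (by simpa using ⟨hl, hm⟩)]
    exact ⟨⟨l, m, hlm, rfl⟩, by grind [crossWeight]⟩
  all_goals
    right
    have : crossWeight p q Z m l ≤ p := by grind [crossWeight, labelWeight, DisjointLabels]
    exact ⟨by grind [avoiding], by lia⟩

end Step

section LowerBound

variable {ι : Type*} [LinearOrder ι] {p q : ℕ} {Z A B : List ι} {L M u v : List (ι × ι)}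

theorem IsTriangle.avoiding_or {I : List (ι × ι)} (h : IsTriangle I) (hI : ∀ l ∈ I, l.2 ∉ Z) :
    (IsTriangle (avoiding Z I) ∧
        pairSum (crossWeight p q Z) I.reverse ≤ pairSum (crossWeight p q Z) I) ∨
      (avoiding Z I.reverse = avoiding Z I ∧
        pairSum (crossWeight p q Z) I.reverse ≤ pairSum (crossWeight p q Z) I + q) := by
  have weight_up {x y z : ι} (hyz : y < z) (hy : y ∉ Z) :
      pairSum (crossWeight p q Z) [(x, y), (x, z), (y, z)] = if x ∈ Z then q else 0 := by
    have := hyz.ne'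
    simp only [pairSum, List.map_cons, List.map_nil, List.sum_cons, List.sum_nil]
    grind [crossWeight, labelWeight]
  have weight_down {x y z : ι} (hy : y ∉ Z) :
      pairSum (crossWeight p q Z) [(y, z), (x, z), (x, y)] = 0 := by
    simp only [pairSum, List.map_cons, List.map_nil, List.sum_cons, List.sum_nil]
    grind [crossWeight]
  cases h with
  | @up x y z hxy hyz =>
    have hy : y ∉ Z := hI (x, y) (by simp)
    have hz : z ∉ Z := hI (x, z) (by simp)
    simp only [List.reverse_cons, List.reverse_nil, List.nil_append, List.cons_append,
      weight_up hyz hy, weight_down hy]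
    by_cases hx : x ∈ Z
    · exact .inr ⟨by simp [avoiding, List.filter_cons, hx], by simp⟩
    · exact .inl ⟨by simpa [avoiding, hx, hy, hz] using .up hxy hyz, by simp⟩
  | @down x y z hxy hyz =>
    have hy : y ∉ Z := hI (x, y) (by simp)
    have hz : z ∉ Z := hI (x, z) (by simp)
    simp only [List.reverse_cons, List.reverse_nil, List.nil_append, List.cons_append,
      weight_up hyz hy, weight_down hy]
    by_cases hx : x ∈ Z
    · exact .inr ⟨by simp [avoiding, List.filter_cons, hx], by simp [hx]⟩
    · exact .inl ⟨by simpa [avoiding, hx, hy, hz] using .down hxy hyz, by simp [hx]⟩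

theorem LabelReach.exists_avoiding {c : ℕ} (h : LabelReach p q L M c) (hL : ∀ l ∈ L, l.2 ∉ Z) :
    ∃ d, LabelReach p q (avoiding Z L) (avoiding Z M) d ∧
      pairSum (crossWeight p q Z) M + d ≤ pairSum (crossWeight p q Z) L + c := by
  induction h with
  | refl => exact ⟨0, .refl _, le_rfl⟩
  | fst h _ ih =>
    obtain ⟨d, hd, hle⟩ := ih fun l hl => hL l (h.perm.mem_iff.2 hl)
    rcases h.avoiding_or (p := p) (q := q) (fun I hI _ => hI.avoiding_or) hL with
      ⟨move, hW⟩ | ⟨eq, hW⟩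
    · exact ⟨p + d, .fst move hd, by lia⟩
    · exact ⟨d, eq ▸ hd, by lia⟩
  | snd h _ ih =>
    obtain ⟨d, hd, hle⟩ := ih fun l hl => hL l (h.perm.mem_iff.2 hl)
    rcases h.avoiding_or (p := p) (q := q) (fun I => IsTriangle.avoiding_or) hL with
      ⟨move, hW⟩ | ⟨eq, hW⟩
    · exact ⟨q + d, .snd move hd, by lia⟩
    · exact ⟨d, eq ▸ hd, by lia⟩

theorem Sorts.notMem_of_mem (hA : (Z ++ A).Nodup) (hu : Sorts A u B) {l : ι × ι} (hl : l ∈ u) :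
    l.1 ∉ Z ∧ l.2 ∉ Z := by
  have := hu.mem_of_mem hl
  grind [List.nodup_append]

theorem Sorts.pairSum_crossWeight_append_columns (hA : (Z ++ A).Nodup) (hu : Sorts A u B) :
    pairSum (crossWeight p q Z) (u ++ ReducedWords.columns Z B) = 0 := by
  have fst_mem_u : ∀ l ∈ u, ∀ m, crossWeight p q Z l m = 0 := fun l hl m => by
    have := hu.notMem_of_mem hA hl
    grind [crossWeight]
  have pairwise_Z : Z.Pairwise fun s t => Z.idxOf s < Z.idxOf t := by
    have hZ := (List.nodup_append.1 hA).1
    rw [List.pairwise_iff_getElem]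
    intro i j hi hj hij
    rwa [hZ.idxOf_getElem, hZ.idxOf_getElem]
  refine pairSum_eq_zero (List.pairwise_append.2 ⟨?_, ?_, fun l hl m _ => fst_mem_u l hl m⟩)
  · exact List.pairwise_of_forall_mem_list fun l hl m _ => fst_mem_u l hl m
  · refine List.pairwise_flatMap.2 ⟨fun z _ => ?_, List.pairwise_reverse.2 ?_⟩
    · exact List.pairwise_map.2 (List.pairwise_of_forall fun x y => by simp [crossWeight])
    · refine pairwise_Z.imp fun {s t} hst l hl m hm => ?_
      obtain ⟨_, -, rfl⟩ := List.mem_map.1 hl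
      obtain ⟨_, -, rfl⟩ := List.mem_map.1 hm
      simp [crossWeight, hst.le]

theorem sum_sum_ite_idxOf_lt {T : Type*} [DecidableEq T] (p : ℕ) {l : List T} (h : l.Nodup) :
    (l.map fun x => (l.map fun y => if l.idxOf x < l.idxOf y then p else 0).sum).sum =
      l.length.choose 2 * p := by
  induction l with
  | nil => simp
  | cons z l ih =>
    rw [List.nodup_cons] at h
    have head : ∀ y ∈ l, (if (z :: l).idxOf z < (z :: l).idxOf y then p else 0) = p := by grind
    have tail : ∀ x ∈ l,
        ((z :: l).map fun y => if (z :: l).idxOf x < (z :: l).idxOf y then p else 0).sum =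
          (l.map fun y => if l.idxOf x < l.idxOf y then p else 0).sum := fun x hx => by
      rw [List.map_cons, List.sum_cons, if_neg (by simp), zero_add]
      exact congrArg List.sum (List.map_congr_left fun y hy => by grind)
    rw [List.map_cons, List.sum_cons, List.map_congr_left tail, ih h.2, List.map_cons,
      List.sum_cons, if_neg (lt_irrefl _), zero_add, sum_map_eq_length_mul head, ← add_mul,
      List.length_cons, Nat.choose_succ_succ' _ 1, Nat.choose_one_right]

theorem le_pairSum_crossWeight_rows (p q : ℕ) (hA : (Z ++ A).Nodup) :
    p * (A.length.choose 2 * Z.length.choose 2) ≤ pairSum (crossWeight p q Z) (rows Z A) := by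
  have cross : A.Pairwise fun x y =>
      ((Z.reverse.map fun z => (z, x)).map fun l =>
        ((Z.reverse.map fun z => (z, y)).map (crossWeight p q Z l)).sum).sum =
      Z.length.choose 2 * p := by
    refine (List.nodup_append.1 hA).2.1.imp_of_mem fun {x y} hx _ hxy => ?_
    rw [← sum_sum_ite_idxOf_lt p (List.nodup_append.1 hA).1]
    simp only [List.map_map, List.map_reverse, List.sum_reverse]
    refine congrArg List.sum (List.map_congr_left fun z _ => congrArg List.sum ?_)
    refine List.map_congr_left fun z' hz' => ?_
    grind [crossWeight, labelWeight, List.nodup_append]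
  rw [rows, pairSum_flatMap, pairSum_congr cross, pairSum_const, smul_eq_mul]
  refine le_of_eq_of_le ?_ (Nat.le_add_left _ _)
  ring

theorem sum_map_rows {T M : Type*} [AddCommMonoid M] (Z A : List T) (f : T × T → M) :
    ((rows Z A).map f).sum = ((columns Z A).map f).sum := by
  rw [rows, columns, sum_map_flatMap, sum_map_flatMap]
  simp only [List.map_map, Function.comp_def]
  exact sum_map_sum_map_comm ..

theorem Sorts.le_pairSum_crossWeight_rows_append (p q : ℕ) (hA : (Z ++ A).Nodup)
    (hv : Sorts A v B) :
    v.length * (Z.length * ((A.length - 2) * p + q)) +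
        p * (A.length.choose 2 * Z.length.choose 2) ≤
      pairSum (crossWeight p q Z) (ReducedWords.rows Z A ++ v) := by
  have cross : ((ReducedWords.rows Z A).map fun l => (v.map (crossWeight p q Z l)).sum).sum =
      v.length * (Z.length * ((A.length - 2) * p + q)) := by
    rw [sum_map_sum_map_comm]
    refine sum_map_eq_length_mul fun m hm => ?_
    rw [sum_map_rows, ← sum_columns_labelWeight p q Z (List.nodup_append.1 hA).2.1
      (hv.mem_of_mem hm).1 (hv.mem_of_mem hm).2 (hv.lt_of_mem hm).ne]
    refine congrArg List.sum (List.map_congr_left fun l hl => if_pos ?_)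
    rw [List.idxOf_eq_length (hv.notMem_of_mem hA hm).1]
    exact List.idxOf_lt_length_iff.2 (mem_columns.1 hl).1
  have := le_pairSum_crossWeight_rows p q hA
  rw [pairSum_append, cross]
  lia

theorem IsLabelDiam.ge {k D D' : ℕ} (hA : (Z ++ A).Nodup) (hZA : ∀ z ∈ Z, ∀ x ∈ A, z < x)
    (hk : ∀ u, Sorts A u B → u.length = k) (hD : IsLabelDiam p q A B D)
    (hD' : IsLabelDiam p q (Z ++ A) (B ++ Z) D') :
    D + k * (Z.length * ((A.length - 2) * p + q)) +
      p * (A.length.choose 2 * Z.length.choose 2) ≤ D' := by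
  obtain ⟨u, hu : Sorts A u B, v, hv : Sorts A v B, hmin⟩ := hD.2
  have u_columns := (hu.append_left Z).trans
    (Sorts.columns fun z hz x hx => hZA z hz x (hu.perm.mem_iff.2 hx))
  have rows_v := (Sorts.rows hZA).trans (hv.append_right Z)
  obtain ⟨c, hc, reach⟩ := hD'.1 _ u_columns _ rows_v
  obtain ⟨d, hd, hle⟩ := LabelReach.exists_avoiding reach fun l hl => u_columns.snd_notMem hA hl
  rw [avoiding_append, avoiding_append, avoiding_eq_self fun l hl => hu.notMem_of_mem hA hl,
    avoiding_eq_self fun l hl => hv.notMem_of_mem hA hl, avoiding_eq_nil fun l hl =>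
    (mem_columns.1 hl).1, avoiding_eq_nil fun l hl => (mem_rows.1 hl).1, List.append_nil,
    List.nil_append] at hd
  rw [hu.pairSum_crossWeight_append_columns hA] at hle
  have := hv.le_pairSum_crossWeight_rows_append p q hA
  rw [hk v hv] at this
  have := hmin d hd
  lia

end LowerBound

/-! ### Words and label lists -/

/-- `WordSorts A w L B`: the word `w` transforms the list `A` into `B`, each letter `i`
interchanging the entries `x < y` on the positions `i` and `i + 1`, and `L` is the list of the
labels `(x, y)`. -/
inductive WordSorts {ι : Type*} [LinearOrder ι] {m : ℕ} :
    List ι → List (Fin m) → List (ι × ι) → List ι → Prop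
  | nil (A : List ι) : WordSorts A [] [] A
  | cons {P : List ι} {x y : ι} {Q : List ι} {i : Fin m} {w : List (Fin m)} {L : List (ι × ι)}
      {B : List ι} : P.length = i → x < y → WordSorts (P ++ y :: x :: Q) w L B →
      WordSorts (P ++ x :: y :: Q) (i :: w) ((x, y) :: L) B

theorem exists_eq_append_of_lt_length {T : Type*} {n : ℕ} {A : List T} (h : n + 2 < A.length) :
    ∃ P x y z Q, P.length = n ∧ A = P ++ x :: y :: z :: Q := by
  refine ⟨A.take n, A[n], A[n + 1], A[n + 2], A.drop (n + 3), by grind, ?_⟩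
  simp

namespace WordSorts

variable {ι : Type*} [LinearOrder ι] {m : ℕ} {A B B' C P Q R : List ι} {x y z : ι}
  {i j k : Fin m} {w w' : List (Fin m)} {L M : List (ι × ι)}

theorem sorts (h : WordSorts A w L B) : Sorts A L B := by
  induction h with
  | nil => exact .nil _
  | cons _ hxy _ ih => exact .cons hxy ih

theorem length_eq (h : WordSorts A w L B) : w.length = L.length := by
  induction h with
  | nil => rfl
  | cons _ _ _ ih => simp [ih]

theorem add_one_lt_length (h : WordSorts A w L B) (hi : i ∈ w) : i.val + 1 < A.length := by
  induction h with
  | nil => simp at hi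
  | cons hP _ _ ih =>
    rcases List.mem_cons.1 hi with rfl | hi
    · simp [← hP]
    · simpa using ih hi

theorem single (hP : P.length = i) (hxy : x < y) (Q : List ι) :
    WordSorts (P ++ x :: y :: Q) [i] [(x, y)] (P ++ y :: x :: Q) := .cons hP hxy (.nil _)

theorem trans (h : WordSorts A w L B) (h' : WordSorts B w' M C) :
    WordSorts A (w ++ w') (L ++ M) C := by
  induction h with
  | nil => exact h'
  | cons hP hxy _ ih => exact .cons hP hxy (ih h')

theorem exists_of_append_word (h : WordSorts A (w ++ w') L B) :
    ∃ L₁ L₂ C, L = L₁ ++ L₂ ∧ WordSorts A w L₁ C ∧ WordSorts C w' L₂ B := by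
  induction w generalizing A L with
  | nil => exact ⟨[], L, A, rfl, .nil A, h⟩
  | cons i w ih =>
    cases h with
    | cons hP hxy h =>
      obtain ⟨L₁, L₂, C, rfl, h₁, h₂⟩ := ih h
      exact ⟨_, L₂, C, rfl, .cons hP hxy h₁, h₂⟩

theorem exists_of_append_label (h : WordSorts A w (L ++ M) B) :
    ∃ w₁ w₂ C, w = w₁ ++ w₂ ∧ WordSorts A w₁ L C ∧ WordSorts C w₂ M B := by
  induction L generalizing A w with
  | nil => exact ⟨[], w, A, rfl, .nil A, h⟩
  | cons l L ih =>
    cases h with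
    | cons hP hxy h =>
      obtain ⟨w₁, w₂, C, rfl, h₁, h₂⟩ := ih h
      exact ⟨_, w₂, C, rfl, .cons hP hxy h₁, h₂⟩

theorem exists_of_cons (hP : P.length = i) (h : WordSorts (P ++ x :: y :: Q) (i :: w) L B) :
    x < y ∧ ∃ M, L = (x, y) :: M ∧ WordSorts (P ++ y :: x :: Q) w M B := by
  generalize hA : P ++ x :: y :: Q = A at h
  cases h with
  | cons hP' hxy h =>
    obtain ⟨rfl, hQ⟩ := List.append_inj hA (hP.trans hP'.symm)
    obtain ⟨rfl, rfl, rfl⟩ : _ ∧ _ ∧ _ := by simpa only [List.cons.injEq] using hQ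
    exact ⟨hxy, _, rfl, h⟩

theorem label_unique (h : WordSorts A w L B) (h' : WordSorts A w M B') : L = M ∧ B = B' := by
  induction h generalizing M with
  | nil => cases h'; exact ⟨rfl, rfl⟩
  | cons hP _ _ ih =>
    obtain ⟨-, M, rfl, h_tail⟩ := h'.exists_of_cons hP
    obtain ⟨rfl, rfl⟩ := ih h_tail
    exact ⟨rfl, rfl⟩

theorem word_unique (hA : A.Nodup) (h : WordSorts A w L B) (h' : WordSorts A w' L B') :
    w = w' ∧ B = B' := by
  induction h generalizing w' with
  | nil => cases h'; exact ⟨rfl, rfl⟩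
  | @cons P x y Q i w L B hP hxy _ ih =>
    generalize hA' : P ++ x :: y :: Q = A' at h'
    cases h' with
    | cons hP' _ h' =>
      obtain ⟨rfl, hQ⟩ := append_cons_inj_of_nodup hA hA'
      obtain rfl := List.tail_eq_of_cons_eq hQ
      obtain ⟨rfl, rfl⟩ := ih ((Sorts.single P hxy Q).nodup hA) h'
      exact ⟨congrArg (· :: w) (Fin.ext (hP.symm.trans hP')), rfl⟩

theorem exists_of_sorts (h : Sorts A L B) (hA : A.length ≤ m + 1) :
    ∃ w : List (Fin m), WordSorts A w L B := by
  induction h with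
  | nil A => exact ⟨[], .nil A⟩
  | @cons P x y Q L B hxy _ ih =>
    simp only [List.length_append, List.length_cons] at hA
    obtain ⟨w, hw⟩ := ih (by simpa using hA)
    exact ⟨⟨P.length, by lia⟩ :: w, .cons rfl hxy hw⟩

theorem far_left {s t : ι} (hi : P.length = i) (hj : P.length + 2 + Q.length = j) (hxy : x < y)
    (hst : s < t) : WordSorts (P ++ x :: y :: (Q ++ s :: t :: R)) [i, j] [(x, y), (s, t)]
      (P ++ y :: x :: (Q ++ t :: s :: R)) :=
  .cons hi hxy <| by
    simpa using single (P := P ++ y :: x :: Q) (i := j) (by grind) hst R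

theorem far_right {s t : ι} (hi : P.length = i) (hj : P.length + 2 + Q.length = j) (hxy : x < y)
    (hst : s < t) : WordSorts (P ++ x :: y :: (Q ++ s :: t :: R)) [j, i] [(s, t), (x, y)]
      (P ++ y :: x :: (Q ++ t :: s :: R)) := by
  have first := single (P := P ++ x :: y :: Q) (i := j) (by grind) hst R
  simp only [List.append_assoc, List.cons_append] at first
  exact first.trans (single hi hxy _)

theorem comm_or_not_comm (hA : A.Nodup) {l l' : ι × ι} (h : WordSorts A [j, k] [l, l'] B) :
    ((j.val + 1 < k.val ∨ k.val + 1 < j.val) ∧ DisjointLabels l l' ∧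
        WordSorts A [k, j] [l', l] B) ∨
      (¬(j.val + 1 < k.val ∨ k.val + 1 < j.val) ∧ ¬DisjointLabels l l') := by
  obtain _ | @⟨P, x, y, Q, _, _, _, _, hj, hxy, h⟩ := h
  generalize hA' : P ++ y :: x :: Q = A' at h
  obtain _ | @⟨P', s, t, R, _, _, _, _, hk, hst, h⟩ := h
  obtain rfl := h.sorts.eq_of_nil
  rcases List.append_eq_append_iff.1 hA' with ⟨D, rfl, hQ⟩ | ⟨D, rfl, hQ⟩
  · match D with
    | [] | [_] => right; grind [DisjointLabels]
    | _ :: _ :: D =>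
      obtain ⟨rfl, rfl, rfl⟩ : _ ∧ _ ∧ _ := by
        simpa only [List.cons_append, List.cons.injEq] using hQ
      left
      refine ⟨by grind, by grind [DisjointLabels], ?_⟩
      simpa using far_right (j := k) (Q := D) (R := R) hj (by grind) hxy hst
  · match D with
    | [] | [_] => right; grind [DisjointLabels]
    | _ :: _ :: D =>
      obtain ⟨rfl, rfl, rfl⟩ : _ ∧ _ ∧ _ := by
        simpa only [List.cons_append, List.cons.injEq] using hQ
      left
      refine ⟨by grind, by grind [DisjointLabels], ?_⟩
      simpa using far_left (j := j) (Q := D) (R := Q) hk (by grind) hst hxy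

theorem braid_up (hi : P.length = i) (hj : P.length + 1 = j) (hxy : x < y) (hyz : y < z)
    (Q : List ι) : WordSorts (P ++ x :: y :: z :: Q) [i, j, i] [(x, y), (x, z), (y, z)]
      (P ++ z :: y :: x :: Q) := by
  have second := single (P := P ++ [y]) (i := j) (by simpa using hj) (hxy.trans hyz) Q
  simp only [List.append_assoc, List.cons_append, List.nil_append] at second
  exact .cons hi hxy (second.trans (single hi hyz (x :: Q)))

theorem braid_down (hi : P.length = i) (hj : P.length + 1 = j) (hxy : x < y) (hyz : y < z)
    (Q : List ι) : WordSorts (P ++ x :: y :: z :: Q) [j, i, j] [(y, z), (x, z), (x, y)]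
      (P ++ z :: y :: x :: Q) := by
  have first := single (P := P ++ [x]) (i := j) (by simpa using hj) hyz Q
  have third := single (P := P ++ [z]) (i := j) (by simpa using hj) hxy Q
  simp only [List.append_assoc, List.cons_append, List.nil_append] at first third
  exact first.trans (.cons hi (hxy.trans hyz) third)

theorem isTriangle_of_braid (hjk : j.val + 1 = k.val ∨ k.val + 1 = j.val)
    (h : WordSorts A [j, k, j] L B) : IsTriangle L ∧ WordSorts A [k, j, k] L.reverse B := by
  have hj := h.add_one_lt_length (i := j) (by simp)
  have hk := h.add_one_lt_length (i := k) (by simp)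
  rcases hjk with hjk | hjk
  · obtain ⟨P, x, y, z, Q, hP, rfl⟩ := exists_eq_append_of_lt_length (n := j) (A := A) (by lia)
    obtain ⟨hxy, M, rfl, h₂⟩ := h.exists_of_cons hP
    obtain ⟨-, N, rfl, h₃⟩ := exists_of_cons (P := P ++ [y]) (x := x) (y := z) (Q := Q) (i := k)
      (by grind) (by simpa using h₂)
    obtain ⟨hyz, -⟩ := exists_of_cons (P := P) (x := y) (y := z) (Q := x :: Q) hP
      (by simpa using h₃)
    obtain ⟨hL, rfl⟩ := h.label_unique (braid_up hP (hP ▸ hjk) hxy hyz Q)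
    rw [hL]
    exact ⟨.up hxy hyz, braid_down hP (hP ▸ hjk) hxy hyz Q⟩
  · obtain ⟨P, x, y, z, Q, hP, rfl⟩ := exists_eq_append_of_lt_length (n := k) (A := A) (by lia)
    obtain ⟨hyz, M, rfl, h₂⟩ := exists_of_cons (P := P ++ [x]) (x := y) (y := z) (Q := Q) (i := j)
      (by grind) (by simpa using h)
    obtain ⟨-, N, rfl, h₃⟩ := exists_of_cons (P := P) (x := x) (y := z) (Q := y :: Q) hP
      (by simpa using h₂)
    obtain ⟨hxy, -⟩ := exists_of_cons (P := P ++ [z]) (x := x) (y := y) (Q := Q) (i := j)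
      (by grind) (by simpa using h₃)
    obtain ⟨hL, rfl⟩ := h.label_unique (braid_down hP (hP ▸ hjk) hxy hyz Q)
    rw [hL]
    exact ⟨.down hxy hyz, braid_up hP (hP ▸ hjk) hxy hyz Q⟩

theorem braid_of_isTriangle (hA : A.Nodup) (hL : IsTriangle L) (h : WordSorts A w L B) :
    ∃ j k : Fin m, (j.val + 1 = k.val ∨ k.val + 1 = j.val) ∧ w = [j, k, j] ∧
      WordSorts A [k, j, k] L.reverse B := by
  cases hL with
  | @up x y z hxy hyz =>
    obtain _ | @⟨P, _, _, Q, i, _, _, _, hi, -, h_tail⟩ := id h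
    have hA' := (Sorts.single P hxy Q).nodup hA
    generalize eq : P ++ y :: x :: Q = A' at h_tail
    obtain _ | @⟨P', _, _, R, j, _, _, _, hj, -, -⟩ := h_tail
    obtain ⟨rfl, rfl⟩ := append_cons_inj_of_nodup (P := P ++ [y]) (P' := P') (Q' := z :: R)
      (by simpa using hA') (by simpa using eq)
    have hj : P.length + 1 = j := by simpa using hj
    obtain ⟨hw, rfl⟩ := h.word_unique hA (braid_up hi hj hxy hyz R)
    exact ⟨i, j, .inl (hi ▸ hj), hw, braid_down hi hj hxy hyz R⟩
  | @down x y z hxy hyz =>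
    obtain _ | @⟨P, _, _, Q, j, _, _, _, hj, -, h_tail⟩ := id h
    have hA' := (Sorts.single P hyz Q).nodup hA
    generalize eq : P ++ z :: y :: Q = A' at h_tail
    obtain _ | @⟨P', _, _, R, i, _, _, _, hi, -, -⟩ := h_tail
    obtain ⟨rfl, rfl⟩ := append_cons_inj_of_nodup (P' := P' ++ [x]) (Q' := R) hA'
      (by simpa using eq)
    rw [List.append_assoc, List.singleton_append] at hA h ⊢
    have hj : P'.length + 1 = j := by simpa using hj
    obtain ⟨hw, rfl⟩ := h.word_unique hA (braid_down hi hj hxy hyz Q)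
    exact ⟨j, i, .inr (hi ▸ hj), hw, braid_up hi hj hxy hyz Q⟩

end WordSorts

namespace WordSorts

variable {ι : Type*} [LinearOrder ι] {m : ℕ} {A B : List ι} {w w' : List (Fin m)}
  {L M : List (ι × ι)}

theorem exists_of_commMove (hA : A.Nodup) (hw : CommMove w w') (h : WordSorts A w L B) :
    ∃ M, ReverseBlock IsDisjointPair L M ∧ WordSorts A w' M B := by
  obtain ⟨v, v', j, k, hjk, rfl, rfl⟩ := hw
  obtain ⟨_, L₃, C, rfl, h₁₂, h₃⟩ := h.exists_of_append_word
  obtain ⟨L₁, L₂, D, rfl, h₁, h₂⟩ := h₁₂.exists_of_append_word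
  obtain ⟨l, l', rfl⟩ := List.length_eq_two.1 h₂.length_eq.symm
  rcases h₂.comm_or_not_comm (h₁.sorts.nodup hA) with ⟨-, hl, h₂'⟩ | ⟨hjk', -⟩
  · exact ⟨_, ⟨L₁, _, L₃, ⟨l, l', hl, rfl⟩, rfl, rfl⟩, (h₁.trans h₂').trans h₃⟩
  · exact absurd hjk hjk'

theorem exists_of_longBraidMove (hw : LongBraidMove w w') (h : WordSorts A w L B) :
    ∃ M, ReverseBlock IsTriangle L M ∧ WordSorts A w' M B := by
  obtain ⟨v, v', j, k, hjk, rfl, rfl⟩ := hw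
  obtain ⟨_, L₃, C, rfl, h₁₂, h₃⟩ := h.exists_of_append_word
  obtain ⟨L₁, L₂, D, rfl, h₁, h₂⟩ := h₁₂.exists_of_append_word
  obtain ⟨hL₂, h₂'⟩ := h₂.isTriangle_of_braid hjk
  exact ⟨_, ⟨L₁, L₂, L₃, hL₂, rfl, rfl⟩, (h₁.trans h₂').trans h₃⟩

theorem exists_commMove (hA : A.Nodup) (hL : ReverseBlock IsDisjointPair L M)
    (h : WordSorts A w L B) : ∃ w', CommMove w w' ∧ WordSorts A w' M B := by
  obtain ⟨X, _, Y, ⟨l, l', hl, rfl⟩, rfl, rfl⟩ := hL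
  obtain ⟨_, w₃, C, rfl, h₁₂, h₃⟩ := h.exists_of_append_label
  obtain ⟨w₁, w₂, D, rfl, h₁, h₂⟩ := h₁₂.exists_of_append_label
  obtain ⟨j, k, rfl⟩ := List.length_eq_two.1 h₂.length_eq
  rcases h₂.comm_or_not_comm (h₁.sorts.nodup hA) with ⟨hjk, -, h₂'⟩ | ⟨-, hl'⟩
  · exact ⟨_, ⟨w₁, w₃, j, k, hjk, rfl, rfl⟩, (h₁.trans h₂').trans h₃⟩
  · exact absurd hl hl'

theorem exists_longBraidMove (hA : A.Nodup) (hL : ReverseBlock IsTriangle L M)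
    (h : WordSorts A w L B) : ∃ w', LongBraidMove w w' ∧ WordSorts A w' M B := by
  obtain ⟨X, I, Y, hI, rfl, rfl⟩ := hL
  obtain ⟨_, w₃, C, rfl, h₁₂, h₃⟩ := h.exists_of_append_label
  obtain ⟨w₁, w₂, D, rfl, h₁, h₂⟩ := h₁₂.exists_of_append_label
  obtain ⟨j, k, hjk, rfl, h₂'⟩ := h₂.braid_of_isTriangle (h₁.sorts.nodup hA) hI
  exact ⟨_, ⟨w₁, w₃, j, k, hjk, rfl, rfl⟩, (h₁.trans h₂').trans h₃⟩

end WordSorts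

/-! ### Reduced words -/

/-- The number of inversions of a list. -/
def invCount {ι : Type*} [LinearOrder ι] (A : List ι) : ℕ :=
  pairSum (fun x y => if y < x then 1 else 0) A

/-- The one-line notation of `σ`, with the values relabelled by `f`. -/
def oneLine {ι : Type*} {n : ℕ} (f : Fin n → ι) (σ : Equiv.Perm (Fin n)) : List ι :=
  List.ofFn fun i => f (σ i)

theorem oneLine_mul_simpleRefl {ι : Type*} {n : ℕ} (f : Fin n → ι) (σ : Equiv.Perm (Fin n))
    (i : Fin (n - 1)) : ∃ P x y Q, P.length = i.val ∧ oneLine f σ = P ++ x :: y :: Q ∧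
      oneLine f (σ * simpleRefl i) = P ++ y :: x :: Q := by
  have hi : i.val + 1 < (oneLine f σ).length := by grind [oneLine]
  refine ⟨(oneLine f σ).take i, (oneLine f σ)[i.val], (oneLine f σ)[i.val + 1],
    (oneLine f σ).drop (i + 2), by grind, by simp, List.ext_getElem ?_ fun k hk hk' => ?_⟩
  · grind [oneLine]
  · have getElem_oneLine : ∀ (τ : Equiv.Perm (Fin n)) j (hj : j < n),
        (oneLine f τ)[j]'(by simpa [oneLine] using hj) = f (τ ⟨j, hj⟩) := by simp [oneLine]
    rw [getElem_oneLine _ k (by simpa [oneLine] using hk), Equiv.Perm.mul_apply]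
    grind [simpleRefl]

theorem oneLine_perm {ι : Type*} {n : ℕ} (f : Fin n → ι) (σ : Equiv.Perm (Fin n)) :
    (oneLine f 1).Perm (oneLine f σ) :=
  (Equiv.Perm.ofFn_comp_perm σ f).symm

section ReducedWordsSet

variable {ι : Type*} [LinearOrder ι]

theorem invCount_swap (P : List ι) {x y : ι} (h : x < y) (Q : List ι) :
    invCount (P ++ y :: x :: Q) = invCount (P ++ x :: y :: Q) + 1 := by
  have block := pairSum_reverse_block (fun x y : ι => if y < x then 1 else 0) P Q [x, y]
  have pair : pairSum (fun x y : ι => if y < x then 1 else 0) [x, y] = 0 := by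
    simp [pairSum, h.le.not_gt]
  have pair_reverse : pairSum (fun x y : ι => if y < x then 1 else 0) [x, y].reverse = 1 := by
    simp [pairSum, h]
  rw [pair, pair_reverse] at block
  simpa [invCount] using block

theorem Sorts.invCount_eq {A B : List ι} {L : List (ι × ι)} (h : Sorts A L B) :
    invCount B = invCount A + L.length := by
  induction h with
  | nil => rfl
  | @cons P x y Q L B hxy h ih => rw [ih, invCount_swap P hxy Q, List.length_cons]; ring

theorem invCount_eq_zero {A : List ι} (h : A.Pairwise (· < ·)) : invCount A = 0 :=
  pairSum_eq_zero (h.imp fun hxy => if_neg hxy.le.not_gt)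

theorem exists_sorts {A B : List ι} (hA : A.Pairwise (· < ·)) (h : A.Perm B) :
    ∃ L, Sorts A L B := by
  induction A generalizing B with
  | nil => exact ⟨[], List.nil_perm.1 h ▸ .nil _⟩
  | cons z A ih =>
    rw [List.pairwise_cons] at hA
    obtain ⟨P, Q, rfl⟩ := List.append_of_mem (h.mem_iff.1 List.mem_cons_self)
    have hPQ : A.Perm (P ++ Q) := (List.perm_cons z).1 (h.trans List.perm_middle)
    obtain ⟨L, hL⟩ := ih hA.2 hPQ
    exact ⟨_, (hL.append_left [z]).trans
      (Sorts.column (fun x hx => hA.1 x (hPQ.mem_iff.2 (by simp [hx]))) Q)⟩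

variable {n : ℕ} {f : Fin n → ι} {σ τ : Equiv.Perm (Fin n)} {w : List (Fin (n - 1))}
  {L : List (ι × ι)} {B : List ι}

theorem oneLine_nodup (hf : StrictMono f) (σ : Equiv.Perm (Fin n)) : (oneLine f σ).Nodup :=
  List.nodup_ofFn.2 (hf.injective.comp σ.injective)

theorem oneLine_one_pairwise (hf : StrictMono f) : (oneLine f 1).Pairwise (· < ·) :=
  List.pairwise_ofFn.2 fun _ _ hij => hf hij

theorem oneLine_injective (hf : StrictMono f) : Function.Injective (oneLine f) := fun _ _ h =>
  Equiv.ext fun i => hf.injective (congrFun (List.ofFn_injective h) i)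

theorem WordSorts.eq_oneLine (h : WordSorts (oneLine f τ) w L B) :
    B = oneLine f (τ * wordProd w) := by
  induction w generalizing τ L with
  | nil =>
    obtain rfl := List.length_eq_zero_iff.1 h.length_eq.symm
    simp [wordProd, ← h.sorts.eq_of_nil]
  | cons i w ih =>
    obtain ⟨P, x, y, Q, hP, eq, eq_mul⟩ := oneLine_mul_simpleRefl f τ i
    rw [eq] at h
    obtain ⟨-, M, rfl, h_tail⟩ := h.exists_of_cons hP
    rw [← eq_mul] at h_tail
    rw [ih h_tail, mul_assoc, wordProd, wordProd, List.map_cons, List.prod_cons]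

theorem WordSorts.length_eq_invCount (hf : StrictMono f) (h : WordSorts (oneLine f 1) w L B) :
    w.length = invCount B := by
  rw [h.sorts.invCount_eq, invCount_eq_zero (oneLine_one_pairwise hf), zero_add, h.length_eq]

theorem invCount_lt_or_exists_wordSorts (hf : StrictMono f) (w : List (Fin (n - 1))) :
    invCount (oneLine f (wordProd w)) < w.length ∨
      ∃ L, WordSorts (oneLine f 1) w L (oneLine f (wordProd w)) := by
  induction w using List.reverseRecOn with
  | nil => exact .inr ⟨[], .nil _⟩
  | append_singleton w i ih =>
    obtain ⟨P, x, y, Q, hP, eq, eq_mul⟩ := oneLine_mul_simpleRefl f (wordProd w) i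
    have hxy : x ≠ y := by
      have := eq ▸ oneLine_nodup hf (wordProd w)
      grind [List.nodup_append]
    have wordProd_concat : wordProd (w ++ [i]) = wordProd w * simpleRefl i := by simp [wordProd]
    rw [wordProd_concat, eq_mul, List.length_append, List.length_singleton]
    rw [eq] at ih
    rcases hxy.lt_or_gt with hxy | hyx
    · rw [invCount_swap P hxy Q]
      exact ih.imp (by lia) fun ⟨L, hL⟩ => ⟨_, hL.trans (.single hP hxy Q)⟩
    · have := invCount_swap P hyx Q
      rcases ih with hlt | ⟨L, hL⟩
      · left; lia
      · have := hL.length_eq_invCount hf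
        left; lia

theorem permLength_le_length (h : wordProd w = σ) : permLength σ ≤ w.length :=
  Nat.sInf_le ⟨w, rfl, h⟩

theorem exists_wordSorts (h : Sorts (oneLine f 1) L (oneLine f σ)) :
    ∃ w : List (Fin (n - 1)), WordSorts (oneLine f 1) w L (oneLine f σ) :=
  WordSorts.exists_of_sorts h (by simp only [oneLine, List.length_ofFn]; lia)

theorem WordSorts.wordProd_eq (hf : StrictMono f)
    (h : WordSorts (oneLine f 1) w L (oneLine f σ)) : wordProd w = σ := by
  rw [← one_mul (wordProd w)]
  exact (oneLine_injective hf h.eq_oneLine).symm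

theorem permLength_eq_invCount (hf : StrictMono f) (σ : Equiv.Perm (Fin n)) :
    permLength σ = invCount (oneLine f σ) := by
  obtain ⟨L, hL⟩ := exists_sorts (oneLine_one_pairwise hf) (oneLine_perm f σ)
  obtain ⟨v, hv⟩ := exists_wordSorts hL
  refine le_antisymm ?_ ?_
  · exact (permLength_le_length (hv.wordProd_eq hf)).trans_eq (hv.length_eq_invCount hf)
  · obtain ⟨w, hw, rfl⟩ : permLength σ ∈ {k | ∃ w : List (Fin (n - 1)), w.length = k ∧ _} :=
      Nat.sInf_mem ⟨_, v, rfl, hv.wordProd_eq hf⟩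
    rw [← hw]
    rcases invCount_lt_or_exists_wordSorts hf w with hlt | ⟨M, hM⟩
    exacts [hlt.le, (hM.length_eq_invCount hf).ge]

theorem mem_reducedWords_iff (hf : StrictMono f) :
    w ∈ reducedWords σ ↔ ∃ L, WordSorts (oneLine f 1) w L (oneLine f σ) := by
  constructor
  · rintro ⟨rfl, hw⟩
    rw [permLength_eq_invCount hf] at hw
    exact (invCount_lt_or_exists_wordSorts hf w).resolve_left hw.not_gt
  · rintro ⟨L, hL⟩
    exact ⟨hL.wordProd_eq hf, (hL.length_eq_invCount hf).trans (permLength_eq_invCount hf σ).symm⟩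

theorem Sorts.length_eq_permLength (hf : StrictMono f)
    (h : Sorts (oneLine f 1) L (oneLine f σ)) : L.length = permLength σ := by
  rw [permLength_eq_invCount hf, h.invCount_eq, invCount_eq_zero (oneLine_one_pairwise hf),
    zero_add]

end ReducedWordsSet

section Transfer

variable {ι : Type*} [LinearOrder ι] {n : ℕ} {f : Fin n → ι} {σ : Equiv.Perm (Fin n)}
  {L M : List (ι × ι)} {p q c D : ℕ} {u v : reducedWords σ}

theorem labelReach_of_weightedReach (hf : StrictMono f)
    (huv : WeightedReach (commEdges σ).Adj (braidEdges σ).Adj p q u v c)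
    (hu : WordSorts (oneLine f 1) u.val L (oneLine f σ))
    (hv : WordSorts (oneLine f 1) v.val M (oneLine f σ)) : LabelReach p q L M c :=
  huv.simulate
    (R := fun (u : reducedWords σ) L => WordSorts (oneLine f 1) u.val L (oneLine f σ))
    (fun h h' => (h.label_unique h').1)
    (fun huv h => h.exists_of_commMove (oneLine_nodup hf 1) huv)
    (fun huv h => h.exists_of_longBraidMove huv) hu hv

theorem weightedReach_of_labelReach (hf : StrictMono f) (hLM : LabelReach p q L M c)
    (hu : WordSorts (oneLine f 1) u.val L (oneLine f σ))
    (hv : WordSorts (oneLine f 1) v.val M (oneLine f σ)) :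
    WeightedReach (commEdges σ).Adj (braidEdges σ).Adj p q u v c :=
  have hA := oneLine_nodup hf 1
  hLM.simulate
    (R := fun L (u : reducedWords σ) => WordSorts (oneLine f 1) u.val L (oneLine f σ))
    (fun h h' => Subtype.ext (h.word_unique hA h').1)
    (fun hLM h =>
      have ⟨w, hw, hwM⟩ := h.exists_commMove hA hLM
      ⟨⟨w, (mem_reducedWords_iff hf).2 ⟨_, hwM⟩⟩, hw, hwM⟩)
    (fun hLM h =>
      have ⟨w, hw, hwM⟩ := h.exists_longBraidMove hA hLM
      ⟨⟨w, (mem_reducedWords_iff hf).2 ⟨_, hwM⟩⟩, hw, hwM⟩) hu hv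

theorem exists_reducedWord (hf : StrictMono f) (hL : Sorts (oneLine f 1) L (oneLine f σ)) :
    ∃ u : reducedWords σ, WordSorts (oneLine f 1) u.val L (oneLine f σ) :=
  have ⟨w, hw⟩ := exists_wordSorts hL
  ⟨⟨w, (mem_reducedWords_iff hf).2 ⟨L, hw⟩⟩, hw⟩

theorem IsWeightedDiam.isLabelDiam (hf : StrictMono f)
    (hD : IsWeightedDiam (commEdges σ).Adj (braidEdges σ).Adj p q Set.univ D) :
    IsLabelDiam p q (oneLine f 1) (oneLine f σ) D := by
  obtain ⟨reach, u, -, v, -, hmin⟩ := hD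
  refine ⟨fun L hL M hM => ?_, ?_⟩
  · obtain ⟨u, hu⟩ := exists_reducedWord hf hL
    obtain ⟨v, hv⟩ := exists_reducedWord hf hM
    obtain ⟨c, hc, huv⟩ := reach u trivial v trivial
    exact ⟨c, hc, labelReach_of_weightedReach hf huv hu hv⟩
  · obtain ⟨L, hL⟩ := (mem_reducedWords_iff hf).1 u.2
    obtain ⟨M, hM⟩ := (mem_reducedWords_iff hf).1 v.2
    exact ⟨L, hL.sorts, M, hM.sorts, fun c hc =>
      hmin c (weightedReach_of_labelReach hf hc hL hM)⟩

end Transfer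

section Connectivity

variable {n : ℕ} {σ : Equiv.Perm (Fin n)}

theorem exists_weightedReach (p q : ℕ) (u v : reducedWords σ) :
    ∃ c, WeightedReach (commEdges σ).Adj (braidEdges σ).Adj p q u v c := by
  obtain ⟨L, hL⟩ := (mem_reducedWords_iff strictMono_id).1 u.2
  obtain ⟨M, hM⟩ := (mem_reducedWords_iff strictMono_id).1 v.2
  obtain ⟨c, hc⟩ := hL.sorts.exists_labelReach p q (oneLine_nodup strictMono_id 1) hM.sorts
  exact ⟨c, weightedReach_of_labelReach strictMono_id hc hL hM⟩

instance nonempty_reducedWords (σ : Equiv.Perm (Fin n)) : Nonempty (reducedWords σ) :=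
  have ⟨_, hL⟩ := exists_sorts (oneLine_one_pairwise strictMono_id) (oneLine_perm id σ)
  have ⟨u, _⟩ := exists_reducedWord strictMono_id hL
  ⟨u⟩

instance finite_reducedWords (σ : Equiv.Perm (Fin n)) : Finite (reducedWords σ) :=
  ((List.finite_length_eq (Fin (n - 1)) (permLength σ)).subset fun _ h => h.2).to_subtype

end Connectivity

/-! ### Weighted paths as walks -/

section Walks

variable {V : Type*} {H K : SimpleGraph V} {u v : V} {c : ℕ}

theorem WeightedReach.exists_sup_walk (h : WeightedReach H.Adj K.Adj 1 1 u v c) :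
    ∃ w : (H ⊔ K).Walk u v, w.length ≤ c := by
  induction h with
  | refl u => exact ⟨.nil, le_rfl⟩
  | fst h _ ih =>
    obtain ⟨w, hw⟩ := ih
    exact ⟨.cons (.inl h) w, by rw [SimpleGraph.Walk.length_cons]; lia⟩
  | snd h _ ih =>
    obtain ⟨w, hw⟩ := ih
    exact ⟨.cons (.inr h) w, by rw [SimpleGraph.Walk.length_cons]; lia⟩

theorem weightedReach_of_sup_walk (w : (H ⊔ K).Walk u v) :
    WeightedReach H.Adj K.Adj 1 1 u v w.length := by
  induction w with
  | nil => exact .refl _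
  | cons h w ih =>
    rw [SimpleGraph.Walk.length_cons, add_comm]
    exact h.elim (.fst · ih) (.snd · ih)

theorem weightedReach_of_reachable (h : H.Reachable u v) :
    WeightedReach H.Adj K.Adj 0 1 u v 0 := by
  obtain ⟨w⟩ := h
  induction w with
  | nil => exact .refl _
  | cons h _ ih => exact .fst h ih

theorem WeightedReach.exists_contract_walk (h : WeightedReach H.Adj K.Adj 0 1 u v c) :
    ∃ w : (contract (H ⊔ K) H).Walk (H.connectedComponentMk u) (H.connectedComponentMk v),
      w.length ≤ c := by
  induction h with
  | refl u => exact ⟨.nil, le_rfl⟩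
  | fst h _ ih =>
    obtain ⟨w, hw⟩ := ih
    rw [SimpleGraph.ConnectedComponent.sound h.reachable]
    exact ⟨w, by lia⟩
  | @snd u u' _ _ h _ ih =>
    obtain ⟨w, hw⟩ := ih
    by_cases eq : H.connectedComponentMk u = H.connectedComponentMk u'
    · rw [eq]
      exact ⟨w, by lia⟩
    · have adj : (contract (H ⊔ K) H).Adj (H.connectedComponentMk u) (H.connectedComponentMk u') :=
        ⟨eq, u, u', rfl, rfl, .inr h⟩
      exact ⟨.cons adj w, by rw [SimpleGraph.Walk.length_cons]; lia⟩

theorem weightedReach_of_contract_walk {S T : H.ConnectedComponent}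
    (w : (contract (H ⊔ K) H).Walk S T) (hu : H.connectedComponentMk u = S)
    (hv : H.connectedComponentMk v = T) : WeightedReach H.Adj K.Adj 0 1 u v w.length := by
  induction w generalizing u with
  | nil =>
    exact weightedReach_of_reachable (SimpleGraph.ConnectedComponent.exact (hu.trans hv.symm))
  | cons h w ih =>
    obtain ⟨ne, s, t, hs, ht, hst⟩ := id h
    have hus : WeightedReach H.Adj K.Adj 0 1 u s 0 :=
      weightedReach_of_reachable (SimpleGraph.ConnectedComponent.exact (hu.trans hs.symm))
    rcases hst with hst | hst
    · exact absurd (hs.symm.trans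
        ((SimpleGraph.ConnectedComponent.sound hst.reachable).trans ht)) ne
    · simpa only [SimpleGraph.Walk.length_cons, zero_add, add_comm] using
        hus.trans (.snd hst (ih ht hv))

theorem connected_and_isWeightedDiam {W : Type*} [Finite V] [Nonempty V] {r s : V → V → Prop}
    {p q : ℕ} {G : SimpleGraph W} {φ : V → W} (hφ : Function.Surjective φ)
    (reach : ∀ u v, ∃ c, WeightedReach r s p q u v c)
    (walk_of_reach : ∀ {u v c}, WeightedReach r s p q u v c →
      ∃ w : G.Walk (φ u) (φ v), w.length ≤ c)
    (reach_of_walk : ∀ {u v} (w : G.Walk (φ u) (φ v)), WeightedReach r s p q u v w.length) :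
    G.Connected ∧ IsWeightedDiam r s p q Set.univ G.diam := by
  have : Finite W := Finite.of_surjective φ hφ
  have : Nonempty W := .map φ ‹_›
  have connected : G.Connected := by
    refine ⟨hφ.forall₂.2 fun u v => ?_⟩
    obtain ⟨_, hc⟩ := reach u v
    exact ⟨(walk_of_reach hc).choose⟩
  refine ⟨connected, fun u _ v _ => ?_, ?_⟩
  · obtain ⟨w, hw⟩ := connected.exists_walk_length_eq_dist (φ u) (φ v)
    refine ⟨w.length, ?_, reach_of_walk w⟩
    exact hw ▸ SimpleGraph.dist_le_diam (SimpleGraph.connected_iff_ediam_ne_top.1 connected)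
  · obtain ⟨S, T, hST⟩ := G.exists_dist_eq_diam
    obtain ⟨u, rfl⟩ := hφ S
    obtain ⟨v, rfl⟩ := hφ T
    refine ⟨u, trivial, v, trivial, fun c hc => ?_⟩
    obtain ⟨w, hw⟩ := walk_of_reach hc
    exact hST ▸ (SimpleGraph.dist_le w).trans hw

end Walks

section Graphs

variable {n : ℕ} (σ : Equiv.Perm (Fin n))

theorem graphG_connected_and_isWeightedDiam : (graphG σ).Connected ∧
    IsWeightedDiam (commEdges σ).Adj (braidEdges σ).Adj 1 1 Set.univ (graphG σ).diam :=
  connected_and_isWeightedDiam (φ := id) Function.surjective_id (exists_weightedReach 1 1)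
    (·.exists_sup_walk) weightedReach_of_sup_walk

theorem graphC_connected_and_isWeightedDiam : (graphC σ).Connected ∧
    IsWeightedDiam (commEdges σ).Adj (braidEdges σ).Adj 0 1 Set.univ (graphC σ).diam :=
  connected_and_isWeightedDiam (φ := (commEdges σ).connectedComponentMk) Quot.mk_surjective
    (exists_weightedReach 0 1) (·.exists_contract_walk)
    (weightedReach_of_contract_walk · rfl rfl)

theorem graphB_connected_and_isWeightedDiam : (graphB σ).Connected ∧
    IsWeightedDiam (commEdges σ).Adj (braidEdges σ).Adj 1 0 Set.univ (graphB σ).diam := by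
  rw [graphB, graphG, sup_comm]
  exact connected_and_isWeightedDiam (φ := (braidEdges σ).connectedComponentMk)
    Quot.mk_surjective (exists_weightedReach 1 0) (·.swap.exists_contract_walk)
    fun w => (weightedReach_of_contract_walk w rfl rfl).swap

end Graphs

/-! ### The inflation `21[α, ι_b]` -/

section Inflate

variable {a b : ℕ}

theorem oneLine_val_one : oneLine (Fin.val : Fin (a + b) → ℕ) 1 =
    List.range b ++ oneLine (fun i : Fin a => i.val + b) 1 := by
  have one_add : oneLine (Fin.val : Fin (a + b) → ℕ) 1 = List.range (b + a) :=
    List.ext_getElem (by simp [oneLine, add_comm]) (by simp [oneLine])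
  have one : oneLine (fun i : Fin a => i.val + b) 1 = (List.range a).map (b + ·) :=
    List.ext_getElem (by simp [oneLine]) (by simp [oneLine, add_comm])
  rw [one_add, one, List.range_add]

theorem oneLine_val_inflate21 (α : Equiv.Perm (Fin a)) :
    oneLine Fin.val (inflate21 α (1 : Equiv.Perm (Fin b))) =
      oneLine (fun i : Fin a => i.val + b) α ++ List.range b := by
  have range_eq : List.range b = List.ofFn fun i : Fin b => i.val :=
    List.ext_getElem (by simp) (by simp)
  rw [oneLine, List.ofFn_add, range_eq]
  exact congrArg₂ (· ++ ·) (congrArg List.ofFn (funext (inflate21_left α 1)))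
    (congrArg List.ofFn (funext (inflate21_right α 1)))

theorem permLength_mul_cast_sub_two (α : Equiv.Perm (Fin a)) :
    (permLength α : ℤ) * ((a - 2 : ℕ) : ℤ) = permLength α * ((a : ℤ) - 2) := by
  rcases lt_or_ge a 2 with ha | ha
  · have : Subsingleton (Fin a) := Fin.subsingleton_iff_le_one.2 (by lia)
    have : permLength α = 0 :=
      Nat.le_zero.1 (permLength_le_length (w := []) (Subsingleton.elim _ _))
    rw [this, Nat.cast_zero, zero_mul, zero_mul]
  · rw [Nat.cast_sub ha, Nat.cast_ofNat]

theorem weightedDiam_inflate21_bounds {p q D D' : ℕ} {α : Equiv.Perm (Fin a)}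
    (hD : IsWeightedDiam (commEdges α).Adj (braidEdges α).Adj p q Set.univ D)
    (hD' : IsWeightedDiam (commEdges (inflate21 α (1 : Equiv.Perm (Fin b)))).Adj
      (braidEdges (inflate21 α (1 : Equiv.Perm (Fin b)))).Adj p q Set.univ D') :
    (D + permLength α * b * (((a : ℤ) - 2) * p + q) + p * (a.choose 2 * b.choose 2) ≤ D') ∧
      (D' : ℤ) ≤ D + permLength α * b * (((a : ℤ) - 2) * p + q) +
        2 * (p * (a.choose 2 * b.choose 2)) := by
  have hf : StrictMono fun i : Fin a => i.val + b := fun i j hij => by simpa using hij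
  have hA := oneLine_nodup (Fin.val_strictMono (n := a + b)) 1
  have hZA : ∀ z ∈ List.range b, ∀ x ∈ oneLine (fun i : Fin a => i.val + b) 1, z < x := by
    simp only [oneLine, List.mem_range, List.mem_ofFn]
    rintro z hz _ ⟨i, rfl⟩
    lia
  have labelDiam := hD.isLabelDiam hf
  have labelDiam' := hD'.isLabelDiam Fin.val_strictMono
  rw [oneLine_val_one] at hA labelDiam'
  rw [oneLine_val_inflate21] at labelDiam'
  have lower := IsLabelDiam.ge hA hZA (fun _ => Sorts.length_eq_permLength hf) labelDiam labelDiam'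
  have upper := IsLabelDiam.le p q hA (fun _ => Sorts.length_eq_permLength hf) labelDiam labelDiam'
  simp only [oneLine, List.length_ofFn, List.length_range] at lower upper
  have cast_sub := permLength_mul_cast_sub_two α
  zify at lower upper
  constructor
  · linear_combination lower - b * p * cast_sub
  · linear_combination upper + b * p * cast_sub

end Inflate

end ReducedWords

open ReducedWords in
theorem theorem4p6 (a b : ℕ) (α : Equiv.Perm (Fin a)) (π : Equiv.Perm (Fin (a + b)))
    (hπ : π = inflate21 α (1 : Equiv.Perm (Fin b))) :
    -- the six graphs are connected, so that their diameters are genuine maxima of distances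
    ((graphG α).Connected ∧ (graphC α).Connected ∧ (graphB α).Connected ∧
      (graphG π).Connected ∧ (graphC π).Connected ∧ (graphB π).Connected) ∧
    -- (i)
    (((graphG α).diam : ℤ) + permLength α * b * ((a : ℤ) - 1) + a.choose 2 * b.choose 2
        ≤ (graphG π).diam ∧
      ((graphG π).diam : ℤ)
        ≤ (graphG α).diam + permLength α * b * ((a : ℤ) - 1) + 2 * (a.choose 2 * b.choose 2)) ∧
    -- (ii)
    (graphC π).diam = (graphC α).diam + permLength α * b ∧
    -- (iii)
    (((graphB α).diam : ℤ) + permLength α * b * ((a : ℤ) - 2) + a.choose 2 * b.choose 2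
        ≤ (graphB π).diam ∧
      ((graphB π).diam : ℤ)
        ≤ (graphB α).diam + permLength α * b * ((a : ℤ) - 2) + 2 * (a.choose 2 * b.choose 2)) := by
  subst hπ
  obtain ⟨connGα, diamGα⟩ := graphG_connected_and_isWeightedDiam α
  obtain ⟨connCα, diamCα⟩ := graphC_connected_and_isWeightedDiam α
  obtain ⟨connBα, diamBα⟩ := graphB_connected_and_isWeightedDiam α
  obtain ⟨connGπ, diamGπ⟩ := graphG_connected_and_isWeightedDiam (inflate21 α 1)
  obtain ⟨connCπ, diamCπ⟩ := graphC_connected_and_isWeightedDiam (inflate21 α 1)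
  obtain ⟨connBπ, diamBπ⟩ := graphB_connected_and_isWeightedDiam (inflate21 α 1)
  obtain ⟨lowerG, upperG⟩ := weightedDiam_inflate21_bounds diamGα diamGπ
  obtain ⟨lowerC, upperC⟩ := weightedDiam_inflate21_bounds diamCα diamCπ
  obtain ⟨lowerB, upperB⟩ := weightedDiam_inflate21_bounds diamBα diamBπ
  refine ⟨⟨connGα, connCα, connBα, connGπ, connCπ, connBπ⟩, ⟨?_, ?_⟩, ?_, ?_, ?_⟩
  · linear_combination lowerG
  · linear_combination upperG
  · zify
    exact le_antisymm (by linear_combination upperC) (by linear_combination lowerC)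
  · linear_combination lowerB
  · linear_combination upperB
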